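/- Let $n\ge 1$, $0\le\alpha<n$, $p_1>r>1$, $p_2>s>1$, let $\frac1p=\frac1{p_1}+\frac1{p_2}$, and let $0<q<\infty$ satisfy $\frac1q=\frac1p-\frac{\alpha}{n}$. A cube is a cube in $\mathbb R^n$ with sides parallel to the axes and positive finite side length, $|Q|$ is its Lebesgue measure, and integrals are with respect to Lebesgue measure. A weight is a measurable function $w$ on $\mathbb R^n$ with $0<w<\infty$ almost everywhere, and $\|f\|_{L^{t}(w)}=\left(\int_{\mathbb R^n}|f|^{t}\,w\,dx\right)^{1/t}$ for $0<t<\infty$. For measurable $f,g$ put $$\mathcal M^{r,s}_\alpha(f,g)(x)=\sup_{Q\ni x}|Q|^{\frac{\alpha}{n}}\left(\frac1{|Q|}\int_Q|f|^r\right)^{\frac1r}\left(\frac1{|Q|}\int_Q|g|^s\right)^{\frac1s},$$ where the supremum is over all cubes $Q$ containing $x$. Let $w_1,w_2$ be weights. Then there is a finite constant $C$ such that $$\|\mathcal M^{r,s}_\alpha(f,g)\|_{L^q\left(w_1^{q/p_1}w_2^{q/p_2}\right)}\le C\,\|f\|_{L^{p_1}(w_1)}\,\|g\|_{L^{p_2}(w_2)}\qquad\text{for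 all } f\in L^{p_1}(w_1),\ g\in L^{p_2}(w_2)$$ if and only if $$\sup_Q\left(\frac1{|Q|}\int_Q w_1^{\frac q{p_1}}w_2^{\frac q{p_2}}\right)^{\frac1q}\left(\frac1{|Q|}\int_Q w_1^{-\frac r{p_1-r}}\right)^{\frac{p_1-r}{rp_1}}\left(\frac1{|Q|}\int_Q w_2^{-\frac s{p_2-s}}\right)^{\frac{p_2-s}{sp_2}}<\infty,$$ where the supremum is over all cubes $Q$ in $\mathbb R^n$. -/

import Mathlib

open MeasureTheory
open scoped ENNReal NNReal

/-- The closed cube in `ℝⁿ` with sides parallel to the axes, lower corner `a`, side length `ℓ`. -/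
def cube {n : ℕ} (a : Fin n → ℝ) (ℓ : ℝ) : Set (Fin n → ℝ) :=
  Set.Icc a (fun i => a i + ℓ)

/-- A weight on `ℝⁿ`: a Lebesgue measurable function with `0 < w < ∞` almost everywhere. Local
integrability is not required. -/
structure IsWeight {n : ℕ} (w : (Fin n → ℝ) → ℝ≥0∞) : Prop where
  aemeasurable : AEMeasurable w volume
  pos : ∀ᵐ x, 0 < w x
  lt_top : ∀ᵐ x, w x < ∞

/-- The measure `w(x) dx`, so that `L^p(w)` is `L^p` of this measure. -/
noncomputable def weightMeasure {n : ℕ} (w : (Fin n → ℝ) → ℝ≥0∞) : Measure (Fin n → ℝ) :=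
  volume.withDensity w

/-- The bilinear fractional maximal function
`sup_{Q ∋ x} |Q|^(α/n) (⨍_Q |f|^r)^(1/r) (⨍_Q |g|^s)^(1/s)`, with values in `[0, ∞]`. -/
noncomputable def bilinearMaximal {n : ℕ} (α r s : ℝ) (f g : (Fin n → ℝ) → ℂ)
    (x : Fin n → ℝ) : ℝ≥0∞ :=
  ⨆ (a : Fin n → ℝ) (ℓ : ℝ) (_ : 0 < ℓ) (_ : x ∈ cube a ℓ),
    volume (cube a ℓ) ^ (α / n) *
      (⨍⁻ y in cube a ℓ, ‖f y‖ₑ ^ r ∂volume) ^ (1 / r) *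
      (⨍⁻ y in cube a ℓ, ‖g y‖ₑ ^ s ∂volume) ^ (1 / s)

/-- The weight `w₁^(q/p₁) w₂^(q/p₂)`. -/
noncomputable def productWeight {n : ℕ} (p₁ p₂ q : ℝ) (w₁ w₂ : (Fin n → ℝ) → ℝ≥0∞)
    (x : Fin n → ℝ) : ℝ≥0∞ :=
  w₁ x ^ (q / p₁) * w₂ x ^ (q / p₂)

/-- The one-vector-weight power condition. -/
def PowerCondition {n : ℕ} (r s p₁ p₂ q : ℝ) (w₁ w₂ : (Fin n → ℝ) → ℝ≥0∞) : Prop :=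
  (⨆ (a : Fin n → ℝ) (ℓ : ℝ) (_ : 0 < ℓ),
    (⨍⁻ x in cube a ℓ, productWeight p₁ p₂ q w₁ w₂ x ∂volume) ^ (1 / q) *
      (⨍⁻ x in cube a ℓ, w₁ x ^ (-(r / (p₁ - r))) ∂volume) ^ ((p₁ - r) / (r * p₁)) *
      (⨍⁻ x in cube a ℓ, w₂ x ^ (-(s / (p₂ - s))) ∂volume) ^ ((p₂ - s) / (s * p₂))) < ∞

/-- The maximal operator maps `L^{p₁}(w₁) × L^{p₂}(w₂)` boundedly into `L^q(u)`. -/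
def StrongBound {n : ℕ} (α r s p₁ p₂ q : ℝ) (w₁ w₂ u : (Fin n → ℝ) → ℝ≥0∞) : Prop :=
  ∃ C : ℝ≥0, ∀ f g : (Fin n → ℝ) → ℂ,
    MemLp f (ENNReal.ofReal p₁) (weightMeasure w₁) →
    MemLp g (ENNReal.ofReal p₂) (weightMeasure w₂) →
    eLpNorm (bilinearMaximal α r s f g) (ENNReal.ofReal q) (weightMeasure u) ≤
      C * eLpNorm f (ENNReal.ofReal p₁) (weightMeasure w₁) *
        eLpNorm g (ENNReal.ofReal p₂) (weightMeasure w₂)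

/-! Write u = w₁^(q/p₁) w₂^(q/p₂), let σ₁, σ₂ be the dual weights w₁^(-r/(p₁-r)), w₂^(-s/(p₂-s)),
and attach to u, σ₁, σ₂ the exponents 1/q, 1/r - 1/p₁, 1/s - 1/p₂, with sum N. The product of the
three weights to these exponents is 1 a.e., and the power condition bounds the same product of their
integrals over Q by K |Q|^N. Hölder gives the reverse bound |E|^N ≤ product for every set E.
Comparing the two, a subset with a fixed share of the volume of Q has a fixed share of the mass of
each weight (`exists_setLIntegral_ball_le`). Hence all three measures are doubling, and their
maximal operators are bounded on L^P for P > 1.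

Sufficiency. Put |f|^r = φσ₁, |g|^s = ψσ₂, β = α/n. Each cube contains a set G with a fixed share of
its u-mass on which u is at most, and σ₁, σ₂ at least, a multiple of their averages
(`exists_good_subset`). For y in G the term of Q is at most C u(Q)^β H(y), where H = u^(-β) (σ₁
M_{σ₁}φ)^(1/r) (σ₂ M_{σ₂}ψ)^(1/s). Averaging the power p/2 of this against u (`exists_term_le`) and
applying Hedberg's inequality bounds the bilinear maximal function by C I^β M_u(H^(p/2))^(2/q), with
I = ∫ H^p u. The L² bound for M_u turns this into I^(1+βq) = I^(q/p), and Hölder with p/p₁ + p/p₂ =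
1 reduces I to the L^(p₁/r)(σ₁) and L^(p₂/s)(σ₂) bounds. The power p/2 serves every p > 0, since M_u
is only ever used on L².

Necessity. Test on σ₁^(1/r) and σ₂^(1/s) restricted to Q, truncated so that their norms are finite.
-/

/-! ### Maximal operators of doubling measures on a metric space. -/

section Maximal

open Metric Set

variable {X : Type*} [PseudoMetricSpace X] [MeasurableSpace X]

/-- The measure `μ` is positive and finite on balls and satisfies `μ(5B) ≤ D μ(B)`. -/
structure IsBallDoubling (μ : Measure X) (D : ℝ≥0) : Prop where
  pos : ∀ c R, 0 < R → μ (ball c R) ≠ 0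
  lt_top : ∀ c R, 0 < R → μ (ball c R) ≠ ∞
  le : ∀ c R, 0 < R → μ (ball c (5 * R)) ≤ D * μ (ball c R)

/-- The uncentred Hardy-Littlewood maximal function over open balls, relative to `μ`. -/
noncomputable def ballMaximal (μ : Measure X) (f : X → ℝ≥0∞) (x : X) : ℝ≥0∞ :=
  ⨆ (c : X) (R : ℝ) (_ : 0 < R) (_ : x ∈ ball c R), ⨍⁻ y in ball c R, f y ∂μ

theorem lt_ballMaximal_iff {μ : Measure X} {f : X → ℝ≥0∞} {x : X} {t : ℝ≥0∞} :
    t < ballMaximal μ f x ↔ ∃ c R, 0 < R ∧ x ∈ ball c R ∧ t < ⨍⁻ y in ball c R, f y ∂μ := by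
  simp only [ballMaximal, lt_iSup_iff, exists_prop]

theorem laverage_le_ballMaximal (μ : Measure X) (f : X → ℝ≥0∞) {x c : X} {R : ℝ} (hR : 0 < R)
    (hx : x ∈ ball c R) : ⨍⁻ y in ball c R, f y ∂μ ≤ ballMaximal μ f x :=
  le_iSup_of_le c (le_iSup_of_le R (le_iSup_of_le hR (le_iSup_of_le hx le_rfl)))

theorem isOpen_lt_ballMaximal (μ : Measure X) (f : X → ℝ≥0∞) (t : ℝ≥0∞) :
    IsOpen {x | t < ballMaximal μ f x} := by
  rw [isOpen_iff_mem_nhds]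
  intro x hx
  obtain ⟨c, R, hR, hxc, ht⟩ := lt_ballMaximal_iff.1 hx
  filter_upwards [isOpen_ball.mem_nhds hxc] with y hy
  exact lt_ballMaximal_iff.2 ⟨c, R, hR, hy, ht⟩

theorem measurable_ballMaximal [OpensMeasurableSpace X] (μ : Measure X) (f : X → ℝ≥0∞) :
    Measurable (ballMaximal μ f) :=
  measurable_of_Ioi fun t => (isOpen_lt_ballMaximal μ f t).measurableSet

theorem ballMaximal_congr {μ : Measure X} {f g : X → ℝ≥0∞} (h : f =ᵐ[μ] g) :
    ballMaximal μ f = ballMaximal μ g := by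
  funext x
  simp only [ballMaximal, laverage_congr (ae_restrict_of_ae h)]

/-- The weak type `(1,1)` inequality, by the Vitali covering lemma. -/
theorem IsBallDoubling.mul_measure_lt_ballMaximal_le [OpensMeasurableSpace X]
    [SecondCountableTopology X] {μ : Measure X} {D : ℝ≥0} (hμ : IsBallDoubling μ D)
    (f : X → ℝ≥0∞) (t : ℝ≥0∞) :
    t * μ {x | t < ballMaximal μ f x} ≤ D * ∫⁻ x, f x ∂μ := by
  -- Vitali's lemma needs bounded radii, so the level set is exhausted by the increasing sets where
  -- a ball of radius at most `k` suffices.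
  set S : ℕ → Set X := fun k =>
    {x | ∃ (c : X) (R : ℝ), 0 < R ∧ R ≤ k ∧ x ∈ ball c R ∧ t < ⨍⁻ y in ball c R, f y ∂μ} with hS
  have hunion : {x | t < ballMaximal μ f x} = ⋃ k, S k := by
    ext x
    simp only [mem_ofPred_eq, lt_ballMaximal_iff, mem_iUnion, hS]
    constructor
    · rintro ⟨c, R, hR, hx, ht⟩
      obtain ⟨k, hk⟩ := exists_nat_ge R
      exact ⟨k, c, R, hR, hk, hx, ht⟩
    · rintro ⟨k, c, R, hR, -, hx, ht⟩
      exact ⟨c, R, hR, hx, ht⟩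
  have hmono : Monotone S := by
    rintro k l hkl x ⟨c, R, hR, hk, hx, ht⟩
    exact ⟨c, R, hR, hk.trans (by exact_mod_cast hkl), hx, ht⟩
  rw [hunion, hmono.measure_iUnion, ENNReal.mul_iSup]
  refine iSup_le fun k => ?_
  set T : Set (X × ℝ) := {b | 0 < b.2 ∧ b.2 ≤ k ∧ t < ⨍⁻ y in ball b.1 b.2, f y ∂μ} with hT
  obtain ⟨u, huT, hdisj, hcov⟩ := Vitali.exists_disjoint_subfamily_covering_enlargement_ball T
    Prod.fst Prod.snd k (fun b hb => hb.2.1) 5 (by norm_num)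
  have hcount : u.Countable := hdisj.countable_of_isOpen (fun _ _ => isOpen_ball)
    fun b hb => nonempty_ball.2 (huT hb).1
  have hsub : S k ⊆ ⋃ b ∈ u, ball b.1 (5 * b.2) := by
    rintro x ⟨c, R, hR, hk, hx, ht⟩
    obtain ⟨b, hb, hsub⟩ := hcov (c, R) ⟨hR, hk, ht⟩
    exact mem_iUnion₂.2 ⟨b, hb, hsub hx⟩
  have hball : ∀ b ∈ u, t * μ (ball b.1 (5 * b.2)) ≤ D * ∫⁻ y in ball b.1 b.2, f y ∂μ := by
    intro b hb
    have h0 := huT hb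
    have h1 : t * μ (ball b.1 b.2) ≤ ∫⁻ y in ball b.1 b.2, f y ∂μ := by
      have := h0.2.2.le
      rwa [setLAverage_eq, ENNReal.le_div_iff_mul_le (Or.inl (hμ.pos _ _ h0.1))
        (Or.inl (hμ.lt_top _ _ h0.1))] at this
    calc t * μ (ball b.1 (5 * b.2)) ≤ t * (D * μ (ball b.1 b.2)) := by
          gcongr; exact hμ.le _ _ h0.1
      _ = D * (t * μ (ball b.1 b.2)) := by ring
      _ ≤ _ := by gcongr
  have := hcount.to_subtype
  calc t * μ (S k) ≤ t * ∑' b : u, μ (ball b.1.1 (5 * b.1.2)) := by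
        gcongr
        refine (measure_mono hsub).trans ?_
        rw [biUnion_eq_iUnion]
        exact measure_iUnion_le _
    _ = ∑' b : u, t * μ (ball b.1.1 (5 * b.1.2)) := ENNReal.tsum_mul_left.symm
    _ ≤ ∑' b : u, D * ∫⁻ y in ball b.1.1 b.1.2, f y ∂μ :=
        ENNReal.tsum_le_tsum fun b => hball b.1 b.2
    _ = D * ∑' b : u, ∫⁻ y in ball b.1.1 b.1.2, f y ∂μ := ENNReal.tsum_mul_left
    _ = D * ∫⁻ y in ⋃ b : u, ball b.1.1 b.1.2, f y ∂μ := by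
        rw [lintegral_iUnion (fun _ => measurableSet_ball) (hdisj.subtype _ _)]
    _ ≤ _ := mul_le_mul_right (setLIntegral_le_lintegral _ _) _

/-- Discarding the part of `f` below the level `t` lowers its maximal function by at most `t`. -/
theorem ballMaximal_le_add {μ : Measure X} {D : ℝ≥0} (hμ : IsBallDoubling μ D)
    (f : X → ℝ≥0∞) (t : ℝ≥0∞) (x : X) :
    ballMaximal μ f x ≤ ballMaximal μ ({y | t < f y}.indicator f) x + t := by
  refine iSup_le fun c => iSup_le fun R => iSup_le fun hR => iSup_le fun hx => ?_
  refine le_trans ?_ (add_le_add_left (laverage_le_ballMaximal μ _ hR hx) t)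
  have h0 := hμ.pos c R hR
  have h1 := hμ.lt_top c R hR
  rw [setLAverage_eq, setLAverage_eq]
  have : ∫⁻ y in ball c R, f y ∂μ ≤
      (∫⁻ y in ball c R, {y | t < f y}.indicator f y ∂μ) + t * μ (ball c R) := by
    rw [← setLIntegral_const, ← lintegral_add_right _ measurable_const]
    refine lintegral_mono fun y => ?_
    by_cases hy : t < f y
    · simp [indicator, hy]
    · simp [indicator, hy, not_lt.1 hy]
  calc _ ≤ ((∫⁻ y in ball c R, {y | t < f y}.indicator f y ∂μ) + t * μ (ball c R)) /
        μ (ball c R) := by gcongr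
    _ = _ := by rw [ENNReal.add_div, ENNReal.mul_div_cancel_right h0 h1]

/-- Where the maximal function exceeds 2t, that of the part of `f` above t still exceeds t, so the
weak type bound sees only that part. This is what makes the layer cake integral converge for P > 1.
-/
theorem IsBallDoubling.mul_measure_two_mul_lt_ballMaximal_le [OpensMeasurableSpace X]
    [SecondCountableTopology X] {μ : Measure X} {D : ℝ≥0} (hμ : IsBallDoubling μ D)
    (f : X → ℝ≥0∞) (t : ℝ≥0∞) :
    t * μ {x | 2 * t < ballMaximal μ f x} ≤ D * ∫⁻ x, {y | t < f y}.indicator f x ∂μ := by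
  refine le_trans ?_ (hμ.mul_measure_lt_ballMaximal_le _ t)
  refine mul_le_mul_right (measure_mono fun x hx => ?_) _
  have := (show 2 * t < _ from hx).trans_le (ballMaximal_le_add hμ f t x)
  rw [two_mul] at this
  exact lt_of_add_lt_add_right this

theorem lintegral_Ioo_rpow {a γ : ℝ} (ha : 0 ≤ a) (hγ : 0 < γ) :
    ∫⁻ t in Ioo 0 a, ENNReal.ofReal (t ^ (γ - 1)) = ENNReal.ofReal (a ^ γ / γ) := by
  have h1 : IntervalIntegrable (fun t : ℝ => t ^ (γ - 1)) volume 0 a :=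
    intervalIntegral.intervalIntegrable_rpow' (by linarith)
  rw [intervalIntegrable_iff_integrableOn_Ioo_of_le ha] at h1
  rw [← ofReal_integral_eq_lintegral_ofReal h1, ← integral_Ioc_eq_integral_Ioo,
    ← intervalIntegral.integral_of_le ha, integral_rpow (Or.inl (by linarith))]
  · simp [Real.zero_rpow hγ.ne']
  · filter_upwards [ae_restrict_mem measurableSet_Ioo] with t ht
    exact Real.rpow_nonneg ht.1.le _

/-- The layer cake formula for a single value. -/
theorem lintegral_Ioi_rpow_indicator (a : ℝ≥0∞) {γ : ℝ} (hγ : 0 < γ) :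
    ∫⁻ t in Ioi (0 : ℝ), {t : ℝ | ENNReal.ofReal t < a}.indicator
      (fun t => ENNReal.ofReal (t ^ (γ - 1))) t = a ^ γ / ENNReal.ofReal γ := by
  have key : ∀ b : ℝ, 0 ≤ b → ∫⁻ t in Ioi (0 : ℝ),
      {t : ℝ | ENNReal.ofReal t < ENNReal.ofReal b}.indicator
      (fun t => ENNReal.ofReal (t ^ (γ - 1))) t = ENNReal.ofReal b ^ γ / ENNReal.ofReal γ := by
    intro b hb
    have hm : MeasurableSet {t : ℝ | ENNReal.ofReal t < ENNReal.ofReal b} :=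
      measurableSet_lt ENNReal.measurable_ofReal measurable_const
    rw [lintegral_indicator hm, Measure.restrict_restrict hm]
    have : {t : ℝ | ENNReal.ofReal t < ENNReal.ofReal b} ∩ Ioi 0 = Ioo 0 b := by
      ext t
      simp only [mem_inter_iff, mem_ofPred_eq, mem_Ioi, mem_Ioo]
      constructor
      · rintro ⟨h1, h2⟩
        exact ⟨h2, (ENNReal.ofReal_lt_ofReal_iff_of_nonneg h2.le).1 h1⟩
      · rintro ⟨h1, h2⟩
        exact ⟨(ENNReal.ofReal_lt_ofReal_iff_of_nonneg h1.le).2 h2, h1⟩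
    rw [this, lintegral_Ioo_rpow hb hγ, ENNReal.ofReal_div_of_pos hγ,
      ENNReal.ofReal_rpow_of_nonneg hb hγ.le]
  by_cases ha : a = ∞
  · subst ha
    rw [ENNReal.top_rpow_of_pos hγ, ENNReal.top_div_of_ne_top ENNReal.ofReal_ne_top]
    -- The finite level (rγ)^(1/γ) has integral exactly r, so the integral for the infinite value
    -- exceeds every r.
    refine ENNReal.eq_top_of_forall_nnreal_le fun r => ?_
    have h2 := key ((r * γ) ^ (1 / γ)) (by positivity)
    rw [← ENNReal.ofReal_rpow_of_nonneg (by positivity) (by positivity), ← ENNReal.rpow_mul,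
      one_div_mul_cancel hγ.ne', ENNReal.rpow_one, ← ENNReal.ofReal_div_of_pos hγ,
      mul_div_cancel_right₀ _ hγ.ne', ENNReal.ofReal_coe_nnreal] at h2
    rw [← h2]
    refine lintegral_mono fun t => indicator_le_indicator_of_subset ?_ (fun _ => zero_le) t
    intro t ht
    exact ENNReal.ofReal_lt_top
  · have := key a.toReal ENNReal.toReal_nonneg
    rwa [ENNReal.ofReal_toReal ha] at this

/-- The layer cake formula for powers of an extended nonnegative function. -/
theorem lintegral_rpow_eq_lintegral_layers {Y : Type*} [MeasurableSpace Y] {μ : Measure Y}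
    [SFinite μ] {w F : Y → ℝ≥0∞}
    (hw : Measurable w) (hF : Measurable F) {γ : ℝ} (hγ : 0 < γ) :
    ∫⁻ x, w x * F x ^ γ ∂μ = ENNReal.ofReal γ * ∫⁻ t in Ioi (0 : ℝ), ENNReal.ofReal (t ^ (γ - 1)) *
      ∫⁻ x, {x | ENNReal.ofReal t < F x}.indicator w x ∂μ := by
  have hγ0 : ENNReal.ofReal γ ≠ 0 := by simpa using hγ
  have hms : MeasurableSet {z : Y × ℝ | ENNReal.ofReal z.2 < F z.1} :=
    measurableSet_lt (ENNReal.measurable_ofReal.comp measurable_snd) (hF.comp measurable_fst)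
  have h1 : ∀ x, w x * F x ^ γ = ∫⁻ t in Ioi (0 : ℝ), ENNReal.ofReal γ *
      {z : Y × ℝ | ENNReal.ofReal z.2 < F z.1}.indicator
        (fun z => w z.1 * ENNReal.ofReal (z.2 ^ (γ - 1))) (x, t) := by
    intro x
    have := lintegral_Ioi_rpow_indicator (F x) hγ
    have hm : MeasurableSet {t : ℝ | ENNReal.ofReal t < F x} :=
      measurableSet_lt ENNReal.measurable_ofReal measurable_const
    rw [lintegral_const_mul' _ _ ENNReal.ofReal_ne_top]
    have h2 : ∀ t, {z : Y × ℝ | ENNReal.ofReal z.2 < F z.1}.indicator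
        (fun z => w z.1 * ENNReal.ofReal (z.2 ^ (γ - 1))) (x, t) =
        w x * {t : ℝ | ENNReal.ofReal t < F x}.indicator
          (fun t => ENNReal.ofReal (t ^ (γ - 1))) t := by
      intro t
      by_cases h : ENNReal.ofReal t < F x <;> simp [indicator, h]
    simp_rw [h2]
    rw [lintegral_const_mul _ (Measurable.indicator (by fun_prop) hm), this, ← mul_assoc,
      mul_comm (ENNReal.ofReal γ), mul_assoc, ENNReal.mul_div_cancel hγ0 ENNReal.ofReal_ne_top]
  simp_rw [h1]
  rw [lintegral_lintegral_swap, ← lintegral_const_mul' _ _ ENNReal.ofReal_ne_top]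
  · refine lintegral_congr fun t => ?_
    rw [lintegral_const_mul' _ _ ENNReal.ofReal_ne_top]
    congr 1
    rw [← lintegral_const_mul' (ENNReal.ofReal (t ^ (γ - 1))) _ ENNReal.ofReal_ne_top]
    refine lintegral_congr fun x => ?_
    by_cases h : ENNReal.ofReal t < F x <;> simp [indicator, h, mul_comm]
  · refine Measurable.aemeasurable ?_
    exact (Measurable.indicator (by fun_prop) hms).const_mul _

/-- The maximal operator of a doubling measure is bounded on `L^P` for `P > 1`. -/
theorem IsBallDoubling.lintegral_ballMaximal_rpow_le [OpensMeasurableSpace X]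
    [SecondCountableTopology X] {μ : Measure X} [SFinite μ] {D : ℝ≥0} (hμ : IsBallDoubling μ D)
    {P : ℝ} (hP : 1 < P) :
    ∃ C : ℝ≥0, ∀ f : X → ℝ≥0∞, AEMeasurable f μ →
      ∫⁻ x, ballMaximal μ f x ^ P ∂μ ≤ C * ∫⁻ x, f x ^ P ∂μ := by
  have hP0 : 0 < P := by linarith
  have hP1 : 0 < P - 1 := by linarith
  -- 2^P comes from halving the maximal function, D from the weak type bound, and P/(P-1) from the
  -- layer cake formulas with exponents P on the left and P - 1 on the right.
  refine ⟨2 ^ P * P.toNNReal * D / (P - 1).toNNReal, ?_⟩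
  suffices H : ∀ f : X → ℝ≥0∞, Measurable f →
      ∫⁻ x, ballMaximal μ f x ^ P ∂μ ≤
        ((2 ^ P * P.toNNReal * D / (P - 1).toNNReal : ℝ≥0) : ℝ≥0∞) * ∫⁻ x, f x ^ P ∂μ by
    intro f hf
    rw [ballMaximal_congr hf.ae_eq_mk]
    refine (H _ hf.measurable_mk).trans_eq ?_
    congr 1
    refine lintegral_congr_ae ?_
    filter_upwards [hf.ae_eq_mk] with x hx
    rw [hx]
  intro f hf
  have hγ0 : ENNReal.ofReal (P - 1) ≠ 0 := by simpa using hP1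
  have e1 : ∫⁻ x, ballMaximal μ f x ^ P ∂μ =
      2 ^ P * ∫⁻ x, 1 * (ballMaximal μ f x / 2) ^ P ∂μ := by
    rw [← lintegral_const_mul' _ _ (ENNReal.rpow_ne_top_of_nonneg hP0.le ENNReal.ofNat_ne_top)]
    refine lintegral_congr fun x => ?_
    rw [one_mul, ← ENNReal.mul_rpow_of_nonneg _ _ hP0.le,
      ENNReal.mul_div_cancel two_ne_zero ENNReal.ofNat_ne_top]
  have e2 := lintegral_rpow_eq_lintegral_layers (μ := μ) (w := fun _ => 1)
    (F := fun x => ballMaximal μ f x / 2) measurable_const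
    ((measurable_ballMaximal μ f).div_const _) hP0
  have e3 := lintegral_rpow_eq_lintegral_layers (μ := μ) hf hf hP1
  have e4 : ∫⁻ x, f x ^ P ∂μ = ∫⁻ x, f x * f x ^ (P - 1) ∂μ := by
    refine lintegral_congr fun x => ?_
    have := ENNReal.rpow_add_of_nonneg (x := f x) 1 (P - 1) zero_le_one hP1.le
    rwa [ENNReal.rpow_one, add_sub_cancel] at this
  have e5 : ∫⁻ t in Ioi (0 : ℝ), ENNReal.ofReal (t ^ (P - 1)) *
        ∫⁻ x, {x | ENNReal.ofReal t < ballMaximal μ f x / 2}.indicator (fun _ => 1) x ∂μ ≤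
      ∫⁻ t in Ioi (0 : ℝ), D * (ENNReal.ofReal (t ^ (P - 1 - 1)) *
        ∫⁻ x, {x | ENNReal.ofReal t < f x}.indicator f x ∂μ) := by
    refine setLIntegral_mono' measurableSet_Ioi fun t ht => ?_
    have ht : 0 < t := ht
    have hset : {x | ENNReal.ofReal t < ballMaximal μ f x / 2} =
        {x | 2 * ENNReal.ofReal t < ballMaximal μ f x} := by
      ext x
      simp only [mem_ofPred_eq]
      rw [ENNReal.lt_div_iff_mul_lt (Or.inl two_ne_zero) (Or.inl ENNReal.ofNat_ne_top), mul_comm]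
    have hm : MeasurableSet {x | 2 * ENNReal.ofReal t < ballMaximal μ f x} :=
      (isOpen_lt_ballMaximal μ f _).measurableSet
    have := hμ.mul_measure_two_mul_lt_ballMaximal_le f (ENNReal.ofReal t)
    rw [hset, lintegral_indicator_const hm, one_mul]
    calc ENNReal.ofReal (t ^ (P - 1)) * μ {x | 2 * ENNReal.ofReal t < ballMaximal μ f x}
        = ENNReal.ofReal (t ^ (P - 1 - 1)) *
          (ENNReal.ofReal t * μ {x | 2 * ENNReal.ofReal t < ballMaximal μ f x}) := by
          rw [← mul_assoc, ← ENNReal.ofReal_mul (by positivity), ← Real.rpow_add_one ht.ne',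
            sub_add_cancel]
      _ ≤ ENNReal.ofReal (t ^ (P - 1 - 1)) *
          (D * ∫⁻ x, {y | ENNReal.ofReal t < f y}.indicator f x ∂μ) := by gcongr
      _ = _ := by ring
  rw [e1, e2, e4]
  have hC : ((2 ^ P * P.toNNReal * D / (P - 1).toNNReal : ℝ≥0) : ℝ≥0∞) =
      2 ^ P * ENNReal.ofReal P * D / ENNReal.ofReal (P - 1) := by
    rw [ENNReal.coe_div (by simpa using hP1)]
    push_cast
    rw [ENNReal.coe_rpow_of_nonneg _ hP0.le]
    simp [ENNReal.ofReal]
  rw [hC, e3]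
  rw [lintegral_const_mul' _ _ ENNReal.coe_ne_top] at e5
  calc _ ≤ 2 ^ P * (ENNReal.ofReal P * (D * ∫⁻ t in Ioi (0 : ℝ), (ENNReal.ofReal (t ^ (P - 1 - 1)) *
        ∫⁻ x, {x | ENNReal.ofReal t < f x}.indicator f x ∂μ))) := by gcongr
    _ = _ := by
      rw [← mul_assoc (_ / _), ENNReal.div_mul_cancel hγ0 ENNReal.ofReal_ne_top]
      ring

end Maximal

/-! ### Families of weights with a joint Muckenhoupt condition; balls are open cubes in the sup
norm. -/

section MuckenhouptFamily

open Metric Set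

variable {n : ℕ} {ι : Type*} [Fintype ι]

theorem volume_ball_pi_ne_zero (c : Fin n → ℝ) {R : ℝ} (hR : 0 < R) : volume (ball c R) ≠ 0 :=
  (measure_ball_pos volume c hR).ne'

theorem volume_ball_pi_ne_top (c : Fin n → ℝ) (R : ℝ) : volume (ball c R) ≠ ∞ :=
  measure_ball_lt_top.ne

theorem volume_ball_pi_mul (c c' : Fin n → ℝ) {k R : ℝ} (hk : 0 < k) (hR : 0 < R) :
    volume (ball c (k * R)) = ENNReal.ofReal k ^ n * volume (ball c' R) := by
  rw [Real.volume_pi_ball _ (mul_pos hk hR), Real.volume_pi_ball _ hR, Fintype.card_fin,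
    ← ENNReal.ofReal_pow hk.le, ← ENNReal.ofReal_mul (by positivity), ← mul_pow]
  ring_nf

/-- A family of weights whose weighted geometric mean is `1`, while the weighted geometric mean
of their averages over cubes is bounded. -/
structure IsMuckenhouptFamily (v : ι → (Fin n → ℝ) → ℝ≥0∞) (e : ι → ℝ) (K : ℝ≥0) : Prop where
  measurable : ∀ i, Measurable (v i)
  pos : ∀ i, ∀ᵐ x, v i x ≠ 0
  lt_top : ∀ i, ∀ᵐ x, v i x ≠ ∞
  exponent_pos : ∀ i, 0 < e i
  prod_eq_one : ∀ᵐ x, ∏ i, v i x ^ e i = 1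
  prod_le : ∀ c R, 0 < R →
    ∏ i, (∫⁻ x in ball c R, v i x) ^ e i ≤ K * volume (ball c R) ^ (∑ i, e i)

namespace IsMuckenhouptFamily

variable {v : ι → (Fin n → ℝ) → ℝ≥0∞} {e : ι → ℝ} {K : ℝ≥0}

theorem setLIntegral_ne_zero (h : IsMuckenhouptFamily v e K) (i : ι) {E : Set (Fin n → ℝ)}
    (hE : volume E ≠ 0) : ∫⁻ x in E, v i x ≠ 0 := by
  rw [Ne, lintegral_eq_zero_iff (h.measurable i)]
  intro h0
  have hE' : volume.restrict E ≠ 0 := by rwa [Ne, Measure.restrict_eq_zero]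
  have := ae_neBot.2 hE'
  obtain ⟨x, hx, hx'⟩ := (h0.and (ae_restrict_of_ae (h.pos i))).exists
  exact hx' hx

/-- No weight is assumed locally integrable: since the other integrals are nonzero, one infinite
integral would make the bounded product infinite. -/
theorem setLIntegral_ball_ne_top (h : IsMuckenhouptFamily v e K) (i : ι) (c : Fin n → ℝ) {R : ℝ}
    (hR : 0 < R) : ∫⁻ x in ball c R, v i x ≠ ∞ := by
  classical
  intro htop
  have h1 := h.prod_le c R hR
  rw [← Finset.mul_prod_erase _ _ (Finset.mem_univ i), htop,
    ENNReal.top_rpow_of_pos (h.exponent_pos i), ENNReal.top_mul] at h1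
  · refine (ENNReal.mul_lt_top ENNReal.coe_lt_top ?_).not_ge h1
    exact ENNReal.rpow_lt_top_of_nonneg (Finset.sum_nonneg fun j _ => (h.exponent_pos j).le)
      (volume_ball_pi_ne_top c R)
  · refine Finset.prod_ne_zero_iff.2 fun j _ => ?_
    have := h.setLIntegral_ne_zero j (volume_ball_pi_ne_zero c hR)
    simp [ENNReal.rpow_eq_zero_iff, this, (h.exponent_pos j).le]

/-- Hölder with the normalized exponents `e i / N`, applied to the constant 1 written as the
weighted geometric mean of the family. -/
theorem volume_rpow_le_prod [Nonempty ι] (h : IsMuckenhouptFamily v e K) (E : Set (Fin n → ℝ)) :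
    volume E ^ (∑ i, e i) ≤ ∏ i, (∫⁻ x in E, v i x) ^ e i := by
  set N := ∑ i, e i with hN
  have hN0 : 0 < N := Finset.sum_pos (fun i _ => h.exponent_pos i) Finset.univ_nonempty
  have h1 := ENNReal.lintegral_prod_norm_pow_le (μ := volume.restrict E) Finset.univ
    (f := v) (fun i _ => (h.measurable i).aemeasurable) (p := fun i => e i / N)
    (by rw [← Finset.sum_div, ← hN, div_self hN0.ne'])
    (fun i _ => div_nonneg (h.exponent_pos i).le hN0.le)
  have h2 : ∫⁻ x in E, ∏ i, v i x ^ (e i / N) = volume E := by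
    rw [← setLIntegral_one]
    refine lintegral_congr_ae (ae_restrict_of_ae ?_)
    filter_upwards [h.prod_eq_one] with x hx
    rw [← ENNReal.one_rpow (1 / N), ← hx, ← ENNReal.prod_rpow_of_nonneg (by positivity)]
    simp_rw [← ENNReal.rpow_mul, mul_one_div]
  rw [h2] at h1
  calc volume E ^ N ≤ (∏ i, (∫⁻ x in E, v i x) ^ (e i / N)) ^ N := by gcongr
    _ = _ := by
      rw [← ENNReal.prod_rpow_of_nonneg hN0.le]
      simp_rw [← ENNReal.rpow_mul, div_mul_cancel₀ _ hN0.ne']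

/-- Large subsets of cubes carry a fixed proportion of the mass of each weight. -/
theorem exists_setLIntegral_ball_le (h : IsMuckenhouptFamily v e K) (i : ι) (a : ℝ≥0) :
    ∃ C : ℝ≥0, ∀ c R, 0 < R → ∀ E ⊆ ball c R, volume (ball c R) ≤ a * volume E →
      ∫⁻ x in ball c R, v i x ≤ C * ∫⁻ x in E, v i x := by
  classical
  have : Nonempty ι := ⟨i⟩
  have hei := h.exponent_pos i
  have hN : 0 ≤ ∑ i, e i := Finset.sum_nonneg fun j _ => (h.exponent_pos j).le
  refine ⟨(K * a ^ (∑ i, e i)) ^ (1 / e i), fun c R hR E hE ha => ?_⟩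
  have h1 : ∏ j, (∫⁻ x in ball c R, v j x) ^ e j ≤
      (K * a ^ (∑ i, e i)) * ∏ j, (∫⁻ x in E, v j x) ^ e j := by
    calc _ ≤ K * volume (ball c R) ^ (∑ i, e i) := h.prod_le c R hR
      _ ≤ K * (a * volume E) ^ (∑ i, e i) := by gcongr
      _ = (K * a ^ (∑ i, e i)) * volume E ^ (∑ i, e i) := by
        rw [ENNReal.mul_rpow_of_nonneg _ _ hN, mul_assoc]
      _ ≤ _ := by gcongr; exact h.volume_rpow_le_prod E
  rw [← Finset.mul_prod_erase _ _ (Finset.mem_univ i),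
    ← Finset.mul_prod_erase _ (fun j => (∫⁻ x in E, v j x) ^ e j) (Finset.mem_univ i)] at h1
  set P := ∏ j ∈ Finset.univ.erase i, (∫⁻ x in ball c R, v j x) ^ e j with hP
  have hPE : ∏ j ∈ Finset.univ.erase i, (∫⁻ x in E, v j x) ^ e j ≤ P := by
    refine Finset.prod_le_prod' fun j _ => ?_
    exact ENNReal.rpow_le_rpow (lintegral_mono_set hE) (h.exponent_pos j).le
  have hP0 : P ≠ 0 := Finset.prod_ne_zero_iff.2 fun j _ => by
    have := h.setLIntegral_ne_zero j (volume_ball_pi_ne_zero c hR)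
    simp [ENNReal.rpow_eq_zero_iff, this, (h.exponent_pos j).le]
  have hPt : P ≠ ∞ := ENNReal.prod_ne_top fun j _ =>
    ENNReal.rpow_ne_top_of_nonneg (h.exponent_pos j).le (h.setLIntegral_ball_ne_top j c hR)
  have h2 : (∫⁻ x in ball c R, v i x) ^ e i ≤
      (K * a ^ (∑ i, e i)) * (∫⁻ x in E, v i x) ^ e i := by
    -- The integrals of the other weights over `E` are at most those over the cube, so their product
    -- `P`, nonzero and finite, cancels.
    rw [← ENNReal.mul_le_mul_iff_left hP0 hPt]
    refine h1.trans ?_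
    rw [mul_assoc _ _ P]
    exact mul_le_mul_right (mul_le_mul_right hPE _) _
  have h3 := ENNReal.rpow_le_rpow h2 (z := 1 / e i) (by positivity)
  rw [ENNReal.mul_rpow_of_nonneg _ _ (by positivity), ← ENNReal.rpow_mul, ← ENNReal.rpow_mul,
    mul_one_div_cancel hei.ne', ENNReal.rpow_one, ENNReal.rpow_one] at h3
  rw [ENNReal.coe_rpow_of_nonneg _ (by positivity)]
  push_cast
  rwa [ENNReal.coe_rpow_of_nonneg _ hN]

/-- A ball occupies the share 5⁻ⁿ of its fivefold dilate, so doubling is a case of the comparison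
for large subsets. -/
theorem exists_isBallDoubling (h : IsMuckenhouptFamily v e K) (i : ι) :
    ∃ D, IsBallDoubling (volume.withDensity (v i)) D := by
  obtain ⟨C, hC⟩ := h.exists_setLIntegral_ball_le i (5 ^ n)
  refine ⟨C, ⟨fun c R hR => ?_, fun c R hR => ?_, fun c R hR => ?_⟩⟩
  · rw [withDensity_apply _ measurableSet_ball]
    exact h.setLIntegral_ne_zero i (volume_ball_pi_ne_zero c hR)
  · rw [withDensity_apply _ measurableSet_ball]
    exact h.setLIntegral_ball_ne_top i c hR
  · rw [withDensity_apply _ measurableSet_ball, withDensity_apply _ measurableSet_ball]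
    refine hC c (5 * R) (by positivity) _ (ball_subset_ball (by linarith)) ?_
    rw [volume_ball_pi_mul c c (by norm_num) hR]
    simp

/-- On most of a cube each weight is bounded below by a multiple of its average. -/
theorem exists_volume_lt_le (h : IsMuckenhouptFamily v e K) (i : ι) :
    ∃ A : ℝ≥0, ∀ c R, 0 < R → 4 * volume {y ∈ ball c R |
      A * v i y * volume (ball c R) < ∫⁻ x in ball c R, v i x} ≤ volume (ball c R) := by
  obtain ⟨C, hC⟩ := h.exists_setLIntegral_ball_le i 4
  -- If the bad set filled more than a quarter of the cube, its mass J would satisfy I ≤ C J, while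
  -- integrating its defining inequality gives (C + 1) J ≤ I; as J is positive and finite, this is
  -- absurd.
  refine ⟨C + 1, fun c R hR => ?_⟩
  set I := ∫⁻ x in ball c R, v i x
  set E := {y ∈ ball c R | ((C + 1 : ℝ≥0) : ℝ≥0∞) * v i y * volume (ball c R) < I} with hE
  have hB0 := volume_ball_pi_ne_zero c hR
  have hBt := volume_ball_pi_ne_top c R
  have hEB : E ⊆ ball c R := fun y hy => hy.1
  have hmE : MeasurableSet E := measurableSet_ball.inter
    (measurableSet_lt (((h.measurable i).const_mul _).mul_const _) measurable_const)
  by_contra! hlt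
  have h1 := hC c R hR E hEB hlt.le
  have hI : I ≠ 0 := h.setLIntegral_ne_zero i hB0
  have hIt : I ≠ ∞ := h.setLIntegral_ball_ne_top i c hR
  set J := ∫⁻ x in E, v i x with hJ
  have hJ0 : J ≠ 0 := by
    intro h0
    rw [h0, mul_zero] at h1
    exact hI (le_zero_iff.1 h1)
  have hJt : J ≠ ∞ := ne_top_of_le_ne_top hIt (lintegral_mono_set hEB)
  have h2 : ((C + 1 : ℝ≥0) : ℝ≥0∞) * J * volume (ball c R) ≤ I * volume (ball c R) := by
    calc ((C + 1 : ℝ≥0) : ℝ≥0∞) * J * volume (ball c R)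
        = ∫⁻ x in E, ((C + 1 : ℝ≥0) : ℝ≥0∞) * v i x * volume (ball c R) := by
          rw [lintegral_mul_const' _ _ hBt, lintegral_const_mul' _ _ ENNReal.coe_ne_top]
      _ ≤ ∫⁻ _ in E, I := setLIntegral_mono measurable_const fun x hx => hx.2.le
      _ = I * volume E := setLIntegral_const _ _
      _ ≤ _ := by gcongr
  rw [ENNReal.mul_le_mul_iff_left hB0 hBt] at h2
  have h3 := h2.trans h1
  rw [ENNReal.mul_le_mul_iff_left hJ0 hJt, ENNReal.coe_le_coe] at h3
  exact absurd h3 (by simp)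

/-- Chebyshev's inequality at four times the average. -/
theorem volume_average_lt_le (h : IsMuckenhouptFamily v e K) (i : ι) (c : Fin n → ℝ) {R : ℝ}
    (hR : 0 < R) : 4 * volume {y ∈ ball c R |
      4 * ∫⁻ x in ball c R, v i x < v i y * volume (ball c R)} ≤ volume (ball c R) := by
  set I := ∫⁻ x in ball c R, v i x with hI
  set E := {y ∈ ball c R | 4 * I < v i y * volume (ball c R)}
  have hBt := volume_ball_pi_ne_top c R
  have hI0 : I ≠ 0 := h.setLIntegral_ne_zero i (volume_ball_pi_ne_zero c hR)
  have hIt : I ≠ ∞ := h.setLIntegral_ball_ne_top i c hR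
  have h2 : 4 * volume E * I ≤ volume (ball c R) * I := by
    calc 4 * volume E * I = ∫⁻ _ in E, 4 * I := by rw [setLIntegral_const]; ring
      _ ≤ ∫⁻ x in E, v i x * volume (ball c R) :=
        setLIntegral_mono ((h.measurable i).mul_const _) fun x hx => hx.2.le
      _ = (∫⁻ x in E, v i x) * volume (ball c R) := lintegral_mul_const' _ _ hBt
      _ ≤ I * volume (ball c R) := by
        gcongr
        exact lintegral_mono_set fun y hy => hy.1
      _ = _ := mul_comm _ _
  rwa [ENNReal.mul_le_mul_iff_left hI0 hIt] at h2

/-- In each cube there is a set carrying a fixed proportion of the mass of the first weight, on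
which this weight is at most a multiple of its average, and the others are at least a multiple of
theirs. -/
theorem exists_good_subset {v : Fin 3 → (Fin n → ℝ) → ℝ≥0∞} {e : Fin 3 → ℝ} {K : ℝ≥0}
    (h : IsMuckenhouptFamily v e K) : ∃ A : ℝ≥0, ∀ c R, 0 < R → ∃ G ⊆ ball c R, MeasurableSet G ∧
      (∫⁻ x in ball c R, v 0 x ≤ A * ∫⁻ x in G, v 0 x) ∧
      ∀ y ∈ G, v 0 y * volume (ball c R) ≤ A * (∫⁻ x in ball c R, v 0 x) ∧
        (∫⁻ x in ball c R, v 1 x ≤ A * v 1 y * volume (ball c R)) ∧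
        (∫⁻ x in ball c R, v 2 x ≤ A * v 2 y * volume (ball c R)) := by
  obtain ⟨C, hC⟩ := h.exists_setLIntegral_ball_le 0 4
  obtain ⟨A₁, hA₁⟩ := h.exists_volume_lt_le 1
  obtain ⟨A₂, hA₂⟩ := h.exists_volume_lt_le 2
  refine ⟨C + A₁ + A₂ + 4, fun c R hR => ?_⟩
  set A := C + A₁ + A₂ + 4 with hA
  have hBt := volume_ball_pi_ne_top c R
  set E₀ := {y ∈ ball c R | 4 * ∫⁻ x in ball c R, v 0 x < v 0 y * volume (ball c R)}
  set E₁ := {y ∈ ball c R | A₁ * v 1 y * volume (ball c R) < ∫⁻ x in ball c R, v 1 x}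
  set E₂ := {y ∈ ball c R | A₂ * v 2 y * volume (ball c R) < ∫⁻ x in ball c R, v 2 x}
  have h0 : 4 * volume E₀ ≤ _ := h.volume_average_lt_le 0 c hR
  have h1 : 4 * volume E₁ ≤ _ := hA₁ c R hR
  have h2 : 4 * volume E₂ ≤ _ := hA₂ c R hR
  have hm0 : MeasurableSet E₀ := measurableSet_ball.inter
    (measurableSet_lt measurable_const ((h.measurable 0).mul_const _))
  have hm1 : MeasurableSet E₁ := measurableSet_ball.inter
    (measurableSet_lt (((h.measurable 1).const_mul _).mul_const _) measurable_const)
  have hm2 : MeasurableSet E₂ := measurableSet_ball.inter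
    (measurableSet_lt (((h.measurable 2).const_mul _).mul_const _) measurable_const)
  have hCA : C ≤ A := by rw [hA, add_assoc, add_assoc]; exact le_self_add
  have hA₁A : A₁ ≤ A := by rw [hA, add_comm C, add_assoc, add_assoc]; exact le_self_add
  have hA₂A : A₂ ≤ A := by rw [hA, add_comm _ A₂, add_assoc]; exact le_self_add
  have h4A : ((4 : ℝ≥0) : ℝ≥0∞) ≤ A := ENNReal.coe_le_coe.2 (by rw [hA]; exact le_add_self)
  set G := ball c R \ (E₀ ∪ E₁ ∪ E₂) with hG
  -- Three exceptional sets of at most a quarter each leave at least a quarter of the cube, which is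
  -- why the comparison was taken with ratio 4.
  have hvol : volume (ball c R) ≤ 4 * volume G := by
    have h3 : 4 * volume (ball c R) ≤ 4 * volume G + 3 * volume (ball c R) := by
      calc 4 * volume (ball c R) ≤ 4 * (volume G + (volume E₀ + volume E₁ + volume E₂)) := by
            gcongr
            calc volume (ball c R) ≤ volume (G ∪ (E₀ ∪ E₁ ∪ E₂)) :=
                  measure_mono (by rw [hG, sdiff_union_self]; exact subset_union_left)
              _ ≤ volume G + volume (E₀ ∪ E₁ ∪ E₂) := measure_union_le _ _
              _ ≤ _ := by
                gcongr
                exact (measure_union_le _ _).trans (by gcongr; exact measure_union_le _ _)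
        _ = 4 * volume G + (4 * volume E₀ + 4 * volume E₁ + 4 * volume E₂) := by ring
        _ ≤ 4 * volume G + (volume (ball c R) + volume (ball c R) + volume (ball c R)) := by
            gcongr
        _ = _ := by ring
    have h4 : (4 : ℝ≥0∞) * volume (ball c R) = volume (ball c R) + 3 * volume (ball c R) := by ring
    rw [h4] at h3
    exact (ENNReal.add_le_add_iff_right (ENNReal.mul_ne_top (by simp) hBt)).1 h3
  refine ⟨G, sdiff_subset, measurableSet_ball.diff ((hm0.union hm1).union hm2), ?_, ?_⟩
  · refine (hC c R hR G sdiff_subset (by simpa using hvol)).trans ?_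
    gcongr
  · rintro y ⟨hy, hy'⟩
    simp only [mem_union, not_or] at hy'
    obtain ⟨⟨hy0, hy1⟩, hy2⟩ := hy'
    have k0 := not_lt.1 fun hlt => hy0 ⟨hy, hlt⟩
    have k1 := not_lt.1 fun hlt => hy1 ⟨hy, hlt⟩
    have k2 := not_lt.1 fun hlt => hy2 ⟨hy, hlt⟩
    refine ⟨k0.trans ?_, k1.trans ?_, k2.trans ?_⟩
    · gcongr
      exact_mod_cast h4A
    · gcongr
    · gcongr

end IsMuckenhouptFamily

end MuckenhouptFamily

/-! ### Hedberg's inequality. -/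

section FractionalMaximal

open Metric Set

theorem sq_lintegral_le {X : Type*} [MeasurableSpace X] {μ : Measure X} {g : X → ℝ≥0∞}
    (hg : AEMeasurable g μ) : (∫⁻ x, g x ∂μ) ^ 2 ≤ μ univ * ∫⁻ x, g x ^ 2 ∂μ := by
  have h := ENNReal.lintegral_mul_norm_pow_le (μ := μ) (f := fun x => g x ^ 2) (g := fun _ => 1)
    (hg.pow_const 2) aemeasurable_const (p := 1 / 2) (q := 1 / 2) (by norm_num) (by norm_num)
    (by norm_num)
  have hx : ∀ x, (g x ^ 2) ^ (1 / 2 : ℝ) * 1 ^ (1 / 2 : ℝ) = g x := by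
    intro x
    rw [ENNReal.one_rpow, mul_one, ← ENNReal.rpow_natCast, ← ENNReal.rpow_mul]
    norm_num
  simp_rw [hx] at h
  calc _ ≤ ((∫⁻ x, g x ^ 2 ∂μ) ^ (1 / 2 : ℝ) * (∫⁻ _, 1 ∂μ) ^ (1 / 2 : ℝ)) ^ 2 := by gcongr
    _ = _ := by
      rw [mul_pow, ← ENNReal.rpow_natCast, ← ENNReal.rpow_natCast, ← ENNReal.rpow_mul,
        ← ENNReal.rpow_mul, lintegral_one, mul_comm]
      norm_num

variable {X : Type*} [PseudoMetricSpace X] [MeasurableSpace X]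

/-- Hedberg's inequality for the fractional maximal function relative to a measure. -/
theorem IsBallDoubling.measure_rpow_mul_laverage_rpow_le {μ : Measure X} {D : ℝ≥0}
    (hμ : IsBallDoubling μ D) {p q β : ℝ} (hβ : 0 ≤ β) (hq : 0 < q)
    (hpq : 1 / q = 1 / p - β) {g : X → ℝ≥0∞} (hg : AEMeasurable g μ) {x c : X} {R : ℝ}
    (hR : 0 < R) (hx : x ∈ ball c R) :
    μ (ball c R) ^ β * (⨍⁻ y in ball c R, g y ∂μ) ^ (2 / p) ≤
      (∫⁻ y, g y ^ 2 ∂μ) ^ β * ballMaximal μ g x ^ (2 / q) := by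
  have h0 := hμ.pos c R hR
  have h1 := hμ.lt_top c R hR
  set m := ⨍⁻ y in ball c R, g y ∂μ with hm
  -- The power 2β of the average joins μ(B)^β to give (μ(B) m²)^β, controlled by the L² norm; the
  -- remaining power 2/q is controlled by the maximal function.
  have e1 : 2 / p = 2 * β + 2 / q := by
    have : 1 / p = β + 1 / q := by linarith
    rw [div_eq_mul_one_div, this]; ring
  have h2 : μ (ball c R) * m ^ 2 ≤ ∫⁻ y, g y ^ 2 ∂μ := by
    have := sq_lintegral_le (μ := μ.restrict (ball c R)) hg.restrict
    rw [Measure.restrict_apply_univ] at this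
    rw [hm, setLAverage_eq, ENNReal.div_eq_inv_mul, mul_pow]
    calc _ ≤ μ (ball c R) * ((μ (ball c R))⁻¹ ^ 2 *
          (μ (ball c R) * ∫⁻ y in ball c R, g y ^ 2 ∂μ)) := by gcongr
      _ = (μ (ball c R) * (μ (ball c R))⁻¹) ^ 2 * ∫⁻ y in ball c R, g y ^ 2 ∂μ := by ring
      _ ≤ _ := by
        rw [ENNReal.mul_inv_cancel h0 h1, one_pow, one_mul]
        exact setLIntegral_le_lintegral _ _
  calc _ = (μ (ball c R) * m ^ 2) ^ β * m ^ (2 / q) := by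
        rw [e1, ENNReal.rpow_add_of_nonneg _ _ (by positivity) (by positivity),
          ENNReal.mul_rpow_of_nonneg _ _ hβ, ← ENNReal.rpow_natCast, ← ENNReal.rpow_mul,
          mul_assoc]
        norm_num
    _ ≤ _ := by
      gcongr
      exact laverage_le_ballMaximal μ g hR hx

end FractionalMaximal

/-! ### Boundedness of the bilinear maximal function for a Muckenhoupt family. -/

section BilinearMaximal

open Metric Set

variable {n : ℕ}

/-- The bilinear fractional maximal function over open cubes, relative to a family of weights. -/
noncomputable def familyMaximal (v : Fin 3 → (Fin n → ℝ) → ℝ≥0∞) (β a b : ℝ)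
    (φ ψ : (Fin n → ℝ) → ℝ≥0∞) (x : Fin n → ℝ) : ℝ≥0∞ :=
  ⨆ (c : Fin n → ℝ) (R : ℝ) (_ : 0 < R) (_ : x ∈ ball c R), volume (ball c R) ^ β *
    (⨍⁻ y in ball c R, v 1 y * φ y ∂volume) ^ a * (⨍⁻ y in ball c R, v 2 y * ψ y ∂volume) ^ b

/-- The linearized majorant of the bilinear maximal function. -/
noncomputable def familyMajorant (v : Fin 3 → (Fin n → ℝ) → ℝ≥0∞) (β a b : ℝ)
    (φ ψ : (Fin n → ℝ) → ℝ≥0∞) (y : Fin n → ℝ) : ℝ≥0∞ :=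
  v 0 y ^ (-β) * (v 1 y * ballMaximal (volume.withDensity (v 1)) φ y) ^ a *
    (v 2 y * ballMaximal (volume.withDensity (v 2)) ψ y) ^ b

/-- The average of `w φ` is the average of `w` times the `w`-average of `φ`. At a point where `w` is
comparable to its average from below, both factors become pointwise quantities. -/
theorem laverage_mul_le {w φ : (Fin n → ℝ) → ℝ≥0∞} (hw : Measurable w) (hφ : Measurable φ)
    {c y : Fin n → ℝ} {R : ℝ} (hR : 0 < R) (hy : y ∈ ball c R) {A : ℝ≥0}
    (hwt : ∫⁻ x in ball c R, w x ≠ ∞) (hw0 : ∫⁻ x in ball c R, w x ≠ 0)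
    (hA : ∫⁻ x in ball c R, w x ≤ A * w y * volume (ball c R)) :
    ⨍⁻ y in ball c R, w y * φ y ∂volume ≤ A * (w y * ballMaximal (volume.withDensity w) φ y) := by
  have hB0 := volume_ball_pi_ne_zero c hR
  have hBt := volume_ball_pi_ne_top c R
  have h1 := laverage_le_ballMaximal (volume.withDensity w) φ hR hy
  rw [setLAverage_eq, withDensity_apply _ measurableSet_ball,
    setLIntegral_withDensity_eq_setLIntegral_mul _ hw hφ measurableSet_ball,
    ENNReal.div_le_iff hw0 hwt] at h1
  rw [setLAverage_eq, ENNReal.div_le_iff hB0 hBt]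
  calc _ ≤ ballMaximal (volume.withDensity w) φ y * ∫⁻ x in ball c R, w x := h1
    _ ≤ ballMaximal (volume.withDensity w) φ y * (A * w y * volume (ball c R)) := by gcongr
    _ = _ := by ring

namespace IsMuckenhouptFamily

variable {v : Fin 3 → (Fin n → ℝ) → ℝ≥0∞} {e : Fin 3 → ℝ} {K : ℝ≥0}

theorem measurable_familyMajorant (h : IsMuckenhouptFamily v e K) (β a b : ℝ)
    (φ ψ : (Fin n → ℝ) → ℝ≥0∞) : Measurable (familyMajorant v β a b φ ψ) := by
  have h0 := h.measurable 0
  have h1 := h.measurable 1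
  have h2 := h.measurable 2
  have h3 := measurable_ballMaximal (volume.withDensity (v 1)) φ
  have h4 := measurable_ballMaximal (volume.withDensity (v 2)) ψ
  unfold familyMajorant
  fun_prop

/-- Each term of the bilinear maximal function is controlled by an average of the majorant. -/
theorem exists_term_le (h : IsMuckenhouptFamily v e K) {β a b δ : ℝ} (hβ : 0 ≤ β) (ha : 0 ≤ a)
    (hb : 0 ≤ b) (hδ : 0 < δ) : ∃ C : ℝ≥0, ∀ φ ψ : (Fin n → ℝ) → ℝ≥0∞, Measurable φ →
      Measurable ψ → ∀ c R, 0 < R → volume (ball c R) ^ β *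
        (⨍⁻ y in ball c R, v 1 y * φ y ∂volume) ^ a * (⨍⁻ y in ball c R, v 2 y * ψ y ∂volume) ^ b ≤
      C * ((volume.withDensity (v 0)) (ball c R) ^ β *
        (⨍⁻ y in ball c R, familyMajorant v β a b φ ψ y ^ δ ∂(volume.withDensity (v 0))) ^
          (1 / δ)) := by
  obtain ⟨A, hA⟩ := h.exists_good_subset
  refine ⟨A ^ (1 / δ) * (A ^ β * A ^ a * A ^ b), fun φ ψ hφ hψ c R hR => ?_⟩
  obtain ⟨G, hGB, hmG, hG0, hG⟩ := hA c R hR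
  have hB0 := volume_ball_pi_ne_zero c hR
  have hBt := volume_ball_pi_ne_top c R
  set T := volume (ball c R) ^ β *
    (⨍⁻ y in ball c R, v 1 y * φ y ∂volume) ^ a * (⨍⁻ y in ball c R, v 2 y * ψ y ∂volume) ^ b with hT
  set H := familyMajorant v β a b φ ψ with hH
  have hmH : Measurable H := h.measurable_familyMajorant β a b φ ψ
  set U := ∫⁻ x in ball c R, v 0 x with hU
  have hU0 : U ≠ 0 := h.setLIntegral_ne_zero 0 hB0
  have hUt : U ≠ ∞ := h.setLIntegral_ball_ne_top 0 c hR
  set L : ℝ≥0∞ := (A : ℝ≥0∞) ^ β * (A : ℝ≥0∞) ^ a * (A : ℝ≥0∞) ^ b with hL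
  -- On `G` the upper bound for `v 0` exchanges |B|^β for U^β `v 0 y`^(-β), and the lower bounds for
  -- `v 1`, `v 2` handle the two averages.
  have key : ∀ᵐ y, y ∈ G → T ≤ L * U ^ β * H y := by
    filter_upwards [h.pos 0, h.lt_top 0] with y hy0 hyt hyG
    obtain ⟨k0, k1, k2⟩ := hG y hyG
    have l1 := laverage_mul_le (h.measurable 1) hφ hR (hGB hyG)
      (h.setLIntegral_ball_ne_top 1 c hR) (h.setLIntegral_ne_zero 1 hB0) k1
    have l2 := laverage_mul_le (h.measurable 2) hψ hR (hGB hyG)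
      (h.setLIntegral_ball_ne_top 2 c hR) (h.setLIntegral_ne_zero 2 hB0) k2
    have l0 : volume (ball c R) ^ β ≤ v 0 y ^ (-β) * (A * U) ^ β := by
      rw [ENNReal.rpow_neg, ← ENNReal.mul_le_iff_le_inv, ← ENNReal.mul_rpow_of_nonneg _ _ hβ]
      · gcongr
      · simp [ENNReal.rpow_eq_zero_iff, hy0, hyt]
      · simp [ENNReal.rpow_eq_top_iff, hy0, hyt]
    calc T ≤ (v 0 y ^ (-β) * (A * U) ^ β) *
          (A * (v 1 y * ballMaximal (volume.withDensity (v 1)) φ y)) ^ a *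
          (A * (v 2 y * ballMaximal (volume.withDensity (v 2)) ψ y)) ^ b := by
          rw [hT]; gcongr
      _ = _ := by
        rw [ENNReal.mul_rpow_of_nonneg _ _ hβ, ENNReal.mul_rpow_of_nonneg (A : ℝ≥0∞) _ ha,
          ENNReal.mul_rpow_of_nonneg (A : ℝ≥0∞) _ hb, hH, familyMajorant, hL]
        ring
  -- `T` is constant, so integrating the pointwise bound over `G` against `v 0` costs only the
  -- factor `A` by which the mass of the cube exceeds that of `G`.
  have h1 : T ^ δ * U ≤ A * (L * U ^ β) ^ δ * ∫⁻ y in ball c R, v 0 y * H y ^ δ := by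
    calc T ^ δ * U ≤ T ^ δ * (A * ∫⁻ x in G, v 0 x) := by gcongr
      _ = A * ∫⁻ x in G, T ^ δ * v 0 x := by
        rw [lintegral_const_mul _ (h.measurable 0)]; ring
      _ ≤ A * ∫⁻ x in G, (L * U ^ β) ^ δ * (v 0 x * H x ^ δ) := by
        refine mul_le_mul_right (lintegral_mono_ae ?_) _
        filter_upwards [ae_restrict_of_ae key, ae_restrict_mem hmG] with y hy hyG
        calc T ^ δ * v 0 y ≤ (L * U ^ β * H y) ^ δ * v 0 y := by gcongr; exact hy hyG
          _ = _ := by rw [ENNReal.mul_rpow_of_nonneg _ _ hδ.le]; ring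
      _ = A * ((L * U ^ β) ^ δ * ∫⁻ x in G, (v 0 x * H x ^ δ)) := by
        rw [lintegral_const_mul (f := fun x => v 0 x * H x ^ δ) _
          ((h.measurable 0).mul (hmH.pow_const δ))]
      _ ≤ A * ((L * U ^ β) ^ δ * ∫⁻ x in ball c R, (v 0 x * H x ^ δ)) :=
        mul_le_mul_right (mul_le_mul_right (lintegral_mono_set hGB) _) _
      _ = _ := by ring
  rw [setLAverage_eq, withDensity_apply _ measurableSet_ball,
    setLIntegral_withDensity_eq_setLIntegral_mul _ (h.measurable 0) (hmH.pow_const δ)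
      measurableSet_ball]
  simp only [Pi.mul_apply]
  set J := ∫⁻ y in ball c R, v 0 y * H y ^ δ
  have h2 : T ^ δ ≤ A * (L * U ^ β) ^ δ * (J / U) := by
    rw [← mul_div_assoc]
    exact (ENNReal.le_div_iff_mul_le (Or.inl hU0) (Or.inl hUt)).2 h1
  have h3 := ENNReal.rpow_le_rpow h2 (z := 1 / δ) (by positivity)
  have hδ' : 0 ≤ 1 / δ := by positivity
  rw [← ENNReal.rpow_mul, mul_one_div_cancel hδ.ne', ENNReal.rpow_one,
    ENNReal.mul_rpow_of_nonneg _ _ hδ', ENNReal.mul_rpow_of_nonneg _ _ hδ', ← ENNReal.rpow_mul,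
    mul_one_div_cancel hδ.ne', ENNReal.rpow_one] at h3
  refine h3.trans_eq ?_
  push_cast
  rw [ENNReal.coe_rpow_of_nonneg _ hβ, ENNReal.coe_rpow_of_nonneg _ ha,
    ENNReal.coe_rpow_of_nonneg _ hb, ENNReal.coe_rpow_of_nonneg _ hδ', ← hL, ← hU]
  ring

/-- The `L^p` norm of the majorant, by Hölder's inequality. -/
theorem lintegral_familyMajorant_rpow_le (h : IsMuckenhouptFamily v e K)
    {β p q r s p₁ p₂ : ℝ} (hr : 0 < r) (hs : 0 < s) (hp₁ : 0 < p₁) (hp₂ : 0 < p₂) (hp : 0 < p)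
    (hp' : 1 / p = 1 / p₁ + 1 / p₂) (hq : 1 / q = 1 / p - β)
    (he0 : e 0 = 1 / q) (he1 : e 1 = 1 / r - 1 / p₁) (he2 : e 2 = 1 / s - 1 / p₂)
    {φ ψ : (Fin n → ℝ) → ℝ≥0∞} :
    ∫⁻ y, familyMajorant v β (1 / r) (1 / s) φ ψ y ^ p ∂(volume.withDensity (v 0)) ≤
      (∫⁻ y, ballMaximal (volume.withDensity (v 1)) φ y ^ (p₁ / r)
        ∂(volume.withDensity (v 1))) ^ (p / p₁) *
      (∫⁻ y, ballMaximal (volume.withDensity (v 2)) ψ y ^ (p₂ / s)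
        ∂(volume.withDensity (v 2))) ^ (p / p₂) := by
  set Φ := ballMaximal (volume.withDensity (v 1)) φ with hΦ
  set Ψ := ballMaximal (volume.withDensity (v 2)) ψ with hΨ
  have hmΦ : Measurable Φ := measurable_ballMaximal _ _
  have hmΨ : Measurable Ψ := measurable_ballMaximal _ _
  rw [lintegral_withDensity_eq_lintegral_mul _ (h.measurable 0)
      ((h.measurable_familyMajorant β (1 / r) (1 / s) φ ψ).pow_const p),
    lintegral_withDensity_eq_lintegral_mul _ (h.measurable 1) (hmΦ.pow_const _),
    lintegral_withDensity_eq_lintegral_mul _ (h.measurable 2) (hmΨ.pow_const _)]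
  refine le_trans (lintegral_mono_ae ?_) (ENNReal.lintegral_mul_norm_pow_le
    ((h.measurable 1).mul (hmΦ.pow_const _)).aemeasurable
    ((h.measurable 2).mul (hmΨ.pow_const _)).aemeasurable (by positivity) (by positivity) ?_)
  · filter_upwards [h.prod_eq_one, h.pos 0, h.pos 1, h.pos 2, h.lt_top 0, h.lt_top 1, h.lt_top 2]
      with y hy h0 h1 h2 t0 t1 t2
    refine le_of_eq ?_
    simp only [Pi.mul_apply, familyMajorant, ← hΦ, ← hΨ]
    rw [Fin.prod_univ_three, he0, he1, he2] at hy
    have hr' : 0 ≤ 1 / r := by positivity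
    have hs' : 0 ≤ 1 / s := by positivity
    have hpp₁ : 0 ≤ p / p₁ := by positivity
    have hpp₂ : 0 ≤ p / p₂ := by positivity
    have hy' := congrArg (fun z : ℝ≥0∞ => z ^ p) hy
    simp only [ENNReal.mul_rpow_of_nonneg _ _ hp.le, ENNReal.one_rpow] at hy'
    simp only [ENNReal.mul_rpow_of_nonneg _ _ hp.le, ENNReal.mul_rpow_of_nonneg _ _ hr',
      ENNReal.mul_rpow_of_nonneg _ _ hs', ENNReal.mul_rpow_of_nonneg _ _ hpp₁,
      ENNReal.mul_rpow_of_nonneg _ _ hpp₂, ← ENNReal.rpow_mul] at hy' ⊢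
    -- Since 1 - βp = p/q, the density supplies the power of `v 0` needed for the normalized product
    -- to appear to the power p; the leftover powers of `v 1` and `v 2` are exactly those in
    -- Hölder's inequality.
    have a0 : v 0 y * v 0 y ^ (-β * p) = v 0 y ^ (1 / q * p) := by
      nth_rewrite 1 [← ENNReal.rpow_one (v 0 y)]
      rw [← ENNReal.rpow_add _ _ h0 t0, hq, sub_mul, one_div_mul_cancel hp.ne']
      ring_nf
    have a1 : v 1 y ^ (1 / r * p) = v 1 y ^ ((1 / r - 1 / p₁) * p) * v 1 y ^ (p / p₁) := by
      rw [← ENNReal.rpow_add _ _ h1 t1]; ring_nf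
    have a2 : v 2 y ^ (1 / s * p) = v 2 y ^ ((1 / s - 1 / p₂) * p) * v 2 y ^ (p / p₂) := by
      rw [← ENNReal.rpow_add _ _ h2 t2]; ring_nf
    have b1 : p₁ / r * (p / p₁) = 1 / r * p := by field_simp
    have b2 : p₂ / s * (p / p₂) = 1 / s * p := by field_simp
    rw [b1, b2, a1, a2]
    calc _ = (v 0 y * v 0 y ^ (-β * p)) * v 1 y ^ ((1 / r - 1 / p₁) * p) *
          v 2 y ^ ((1 / s - 1 / p₂) * p) * (v 1 y ^ (p / p₁) * Φ y ^ (1 / r * p) *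
          (v 2 y ^ (p / p₂) * Ψ y ^ (1 / s * p))) := by ring
      _ = _ := by rw [a0, hy', one_mul]
  · rw [div_eq_mul_one_div, div_eq_mul_one_div p p₂, ← mul_add, ← hp', mul_one_div_cancel hp.ne']

/-- The bilinear fractional maximal function is bounded, for a Muckenhoupt family of weights. -/
theorem exists_lintegral_familyMaximal_rpow_le (h : IsMuckenhouptFamily v e K)
    {β p q r s p₁ p₂ : ℝ} (hβ : 0 ≤ β) (hr : 0 < r) (hs : 0 < s) (hrp : r < p₁) (hsp : s < p₂)
    (hp : 0 < p) (hq₀ : 0 < q)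
    (hp' : 1 / p = 1 / p₁ + 1 / p₂) (hq : 1 / q = 1 / p - β)
    (he0 : e 0 = 1 / q) (he1 : e 1 = 1 / r - 1 / p₁) (he2 : e 2 = 1 / s - 1 / p₂) :
    ∃ C : ℝ≥0, ∀ φ ψ : (Fin n → ℝ) → ℝ≥0∞, Measurable φ → Measurable ψ →
      ∫⁻ y, familyMaximal v β (1 / r) (1 / s) φ ψ y ^ q ∂(volume.withDensity (v 0)) ≤
        C * (∫⁻ y, v 1 y * φ y ^ (p₁ / r)) ^ (q / p₁) *
          (∫⁻ y, v 2 y * ψ y ^ (p₂ / s)) ^ (q / p₂) := by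
  have hp₁ : 0 < p₁ := hr.trans hrp
  have hp₂ : 0 < p₂ := hs.trans hsp
  obtain ⟨D₀, hD₀⟩ := h.exists_isBallDoubling 0
  obtain ⟨D₁, hD₁⟩ := h.exists_isBallDoubling 1
  obtain ⟨D₂, hD₂⟩ := h.exists_isBallDoubling 2
  obtain ⟨C₀, hC₀⟩ := hD₀.lintegral_ballMaximal_rpow_le one_lt_two
  obtain ⟨C₁, hC₁⟩ := hD₁.lintegral_ballMaximal_rpow_le ((one_lt_div hr).2 hrp)
  obtain ⟨C₂, hC₂⟩ := hD₂.lintegral_ballMaximal_rpow_le ((one_lt_div hs).2 hsp)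
  obtain ⟨C, hC⟩ := h.exists_term_le hβ (show 0 ≤ 1 / r by positivity)
    (show 0 ≤ 1 / s by positivity) (half_pos hp)
  refine ⟨C ^ q * C₀ * (C₁ ^ (q / p₁) * C₂ ^ (q / p₂)), fun φ ψ hφ hψ => ?_⟩
  set μ := volume.withDensity (v 0) with hμ
  set H := familyMajorant v β (1 / r) (1 / s) φ ψ with hH
  have hmH : Measurable H := h.measurable_familyMajorant _ _ _ φ ψ
  set g : (Fin n → ℝ) → ℝ≥0∞ := fun y => H y ^ (p / 2) with hg
  have hmg : Measurable g := hmH.pow_const _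
  set I := ∫⁻ y, H y ^ p ∂μ with hI
  have hgI : ∫⁻ y, g y ^ 2 ∂μ = I := by
    refine lintegral_congr fun y => ?_
    rw [hg]
    simp only
    rw [← ENNReal.rpow_natCast, ← ENNReal.rpow_mul]
    norm_num
  have hgI' : ∫⁻ y, g y ^ (2 : ℝ) ∂μ = I := by
    rw [← hgI]
    simp only [ENNReal.rpow_two]
  have hpt : ∀ x, familyMaximal v β (1 / r) (1 / s) φ ψ x ≤
      C * (I ^ β * ballMaximal μ g x ^ (2 / q)) := by
    intro x
    refine iSup_le fun c => iSup_le fun R => iSup_le fun hR => iSup_le fun hx => ?_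
    refine (hC φ ψ hφ hψ c R hR).trans (mul_le_mul_right ?_ _)
    have := hD₀.measure_rpow_mul_laverage_rpow_le hβ hq₀ hq hmg.aemeasurable hR hx
    rwa [hgI, show 2 / p = 1 / (p / 2) by field_simp] at this
  have hIle : I ≤ (C₁ * ∫⁻ y, v 1 y * φ y ^ (p₁ / r)) ^ (p / p₁) *
      (C₂ * ∫⁻ y, v 2 y * ψ y ^ (p₂ / s)) ^ (p / p₂) := by
    refine (h.lintegral_familyMajorant_rpow_le hr hs hp₁ hp₂ hp hp' hq he0 he1 he2).trans ?_
    have k1 := hC₁ φ hφ.aemeasurable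
    have k2 := hC₂ ψ hψ.aemeasurable
    rw [lintegral_withDensity_eq_lintegral_mul _ (h.measurable 1) (hφ.pow_const _)] at k1
    rw [lintegral_withDensity_eq_lintegral_mul _ (h.measurable 2) (hψ.pow_const _)] at k2
    exact mul_le_mul' (ENNReal.rpow_le_rpow k1 (by positivity))
      (ENNReal.rpow_le_rpow k2 (by positivity))
  -- The factor I^β raised to q and the one I from the L² bound combine to I^(q/p).
  have hqp : q / p = 1 + β * q := by
    have : 1 / p = 1 / q + β := by linarith
    rw [div_eq_mul_one_div, this, mul_add, mul_one_div_cancel hq₀.ne', mul_comm β]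
  calc ∫⁻ y, familyMaximal v β (1 / r) (1 / s) φ ψ y ^ q ∂μ
      ≤ ∫⁻ y, (C * I ^ β) ^ q * ballMaximal μ g y ^ (2 : ℝ) ∂μ := by
        refine lintegral_mono fun y => ?_
        calc _ ≤ (C * (I ^ β * ballMaximal μ g y ^ (2 / q))) ^ q := by gcongr; exact hpt y
          _ = _ := by
            rw [← mul_assoc, ENNReal.mul_rpow_of_nonneg _ _ hq₀.le,
              ← ENNReal.rpow_mul (ballMaximal μ g y),
              div_mul_cancel₀ _ hq₀.ne']
    _ = (C * I ^ β) ^ q * ∫⁻ y, ballMaximal μ g y ^ (2 : ℝ) ∂μ :=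
        lintegral_const_mul _ ((measurable_ballMaximal μ g).pow_const _)
    _ ≤ (C * I ^ β) ^ q * (C₀ * I) := by
        gcongr
        rw [← hgI']
        exact hC₀ g hmg.aemeasurable
    _ = C ^ q * C₀ * I ^ (q / p) := by
        rw [hqp, ENNReal.rpow_add_of_nonneg _ _ zero_le_one (by positivity), ENNReal.rpow_one,
          ENNReal.mul_rpow_of_nonneg _ _ hq₀.le, ← ENNReal.rpow_mul]
        ring
    _ ≤ C ^ q * C₀ * ((C₁ * ∫⁻ y, v 1 y * φ y ^ (p₁ / r)) ^ (p / p₁) *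
      (C₂ * ∫⁻ y, v 2 y * ψ y ^ (p₂ / s)) ^ (p / p₂)) ^ (q / p) := by gcongr
    _ = _ := by
      have b1 : p / p₁ * (q / p) = q / p₁ := by field_simp
      have b2 : p / p₂ * (q / p) = q / p₂ := by field_simp
      have hqp0 : 0 ≤ q / p := by positivity
      have c1 : 0 ≤ q / p₁ := by positivity
      have c2 : 0 ≤ q / p₂ := by positivity
      rw [ENNReal.mul_rpow_of_nonneg _ _ hqp0, ← ENNReal.rpow_mul, ← ENNReal.rpow_mul, b1, b2,
        ENNReal.mul_rpow_of_nonneg _ _ c1, ENNReal.mul_rpow_of_nonneg _ _ c2]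
      push_cast
      rw [ENNReal.coe_rpow_of_nonneg _ hq₀.le, ENNReal.coe_rpow_of_nonneg _ c1,
        ENNReal.coe_rpow_of_nonneg _ c2]
      ring

end IsMuckenhouptFamily

end BilinearMaximal

/-! ### Closed cubes and sup-norm balls. -/

section Cubes

open Metric Set

variable {n : ℕ}

theorem cube_eq_closedBall (a : Fin n → ℝ) {ℓ : ℝ} (hℓ : 0 ≤ ℓ) :
    cube a ℓ = closedBall (fun i => a i + ℓ / 2) (ℓ / 2) := by
  rw [cube, closedBall_pi _ (by positivity), ← pi_univ_Icc]
  simp only [Real.closedBall_eq_Icc]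
  congr 1
  funext i
  congr 1 <;> ring

theorem closedBall_eq_cube (c : Fin n → ℝ) {R : ℝ} (hR : 0 ≤ R) :
    closedBall c R = cube (fun i => c i - R) (2 * R) := by
  rw [cube_eq_closedBall _ (by positivity)]
  congr 1
  · funext i; ring
  · ring

theorem measurableSet_cube (a : Fin n → ℝ) (ℓ : ℝ) : MeasurableSet (cube a ℓ) :=
  measurableSet_Icc

theorem volume_closedBall_pi_eq_ball (c : Fin n → ℝ) {R : ℝ} (hR : 0 < R) :
    volume (closedBall c R) = volume (ball c R) := by
  rw [Real.volume_pi_closedBall _ hR.le, Real.volume_pi_ball _ hR]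

theorem volume_cube_ne_zero (a : Fin n → ℝ) {ℓ : ℝ} (hℓ : 0 < ℓ) : volume (cube a ℓ) ≠ 0 := by
  rw [cube_eq_closedBall a hℓ.le, volume_closedBall_pi_eq_ball _ (half_pos hℓ)]
  exact volume_ball_pi_ne_zero _ (half_pos hℓ)

theorem volume_cube_ne_top (a : Fin n → ℝ) {ℓ : ℝ} (hℓ : 0 < ℓ) : volume (cube a ℓ) ≠ ∞ := by
  rw [cube_eq_closedBall a hℓ.le]
  exact measure_closedBall_lt_top.ne

theorem cube_subset_ball (a : Fin n → ℝ) {ℓ : ℝ} (hℓ : 0 < ℓ) :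
    cube a ℓ ⊆ ball (fun i => a i + ℓ / 2) ℓ := by
  rw [cube_eq_closedBall a hℓ.le]
  exact closedBall_subset_ball (by linarith)

theorem volume_ball_le_cube (a : Fin n → ℝ) {ℓ : ℝ} (hℓ : 0 < ℓ) :
    volume (ball (fun i => a i + ℓ / 2) ℓ) = 2 ^ n * volume (cube a ℓ) := by
  rw [cube_eq_closedBall a hℓ.le, volume_closedBall_pi_eq_ball _ (half_pos hℓ)]
  have := volume_ball_pi_mul (fun i => a i + ℓ / 2) (fun i => a i + ℓ / 2) two_pos (half_pos hℓ)
  rw [mul_div_cancel₀ _ two_ne_zero] at this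
  rw [this]
  simp

/-- The concentric open cube of twice the side also contains the boundary of the closed cube, at the
price of 2ⁿ in volume. -/
theorem laverage_cube_le (f : (Fin n → ℝ) → ℝ≥0∞) (a : Fin n → ℝ) {ℓ : ℝ} (hℓ : 0 < ℓ) :
    ⨍⁻ y in cube a ℓ, f y ∂volume ≤
      2 ^ n * ⨍⁻ y in ball (fun i => a i + ℓ / 2) ℓ, f y ∂volume := by
  have h2 : (2 : ℝ≥0∞) ^ n ≠ 0 := by simp
  have h2t : (2 : ℝ≥0∞) ^ n ≠ ∞ := by simp
  rw [setLAverage_eq, setLAverage_eq, volume_ball_le_cube a hℓ, ← mul_div_assoc,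
    ENNReal.mul_div_mul_left _ _ h2 h2t]
  exact ENNReal.div_le_div_right (lintegral_mono_set (cube_subset_ball a hℓ)) _

theorem prod_div_rpow {U A B V : ℝ≥0∞} (hV0 : V ≠ 0) (hVt : V ≠ ∞) {a b c : ℝ} (ha : 0 ≤ a)
    (hb : 0 ≤ b) (hc : 0 ≤ c) :
    (U / V) ^ a * (A / V) ^ b * (B / V) ^ c * V ^ (a + b + c) = U ^ a * A ^ b * B ^ c := by
  rw [ENNReal.rpow_add _ _ hV0 hVt, ENNReal.rpow_add _ _ hV0 hVt]
  calc _ = ((U / V) ^ a * V ^ a) * ((A / V) ^ b * V ^ b) * ((B / V) ^ c * V ^ c) := by ring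
    _ = _ := by
      rw [← ENNReal.mul_rpow_of_nonneg _ _ ha, ← ENNReal.mul_rpow_of_nonneg _ _ hb,
        ← ENNReal.mul_rpow_of_nonneg _ _ hc, ENNReal.div_mul_cancel hV0 hVt,
        ENNReal.div_mul_cancel hV0 hVt, ENNReal.div_mul_cancel hV0 hVt]

end Cubes

/-! ### Dual weights and sufficiency of the power condition. -/

section Weights

open Metric Set

variable {n : ℕ}

/-- The dual weight `w^(-r/(p-r))`. -/
noncomputable def dualWeight (r p : ℝ) (w : (Fin n → ℝ) → ℝ≥0∞) (x : Fin n → ℝ) : ℝ≥0∞ :=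
  w x ^ (-(r / (p - r)))

/-- The product weight and the two dual weights. -/
noncomputable def weightFamily (r s p₁ p₂ q : ℝ) (w₁ w₂ : (Fin n → ℝ) → ℝ≥0∞) :
    Fin 3 → (Fin n → ℝ) → ℝ≥0∞ :=
  ![productWeight p₁ p₂ q w₁ w₂, dualWeight r p₁ w₁, dualWeight s p₂ w₂]

/-- The exponents attached to `weightFamily`. -/
noncomputable def exponentFamily (r s p₁ p₂ q : ℝ) : Fin 3 → ℝ :=
  ![1 / q, (p₁ - r) / (r * p₁), (p₂ - s) / (s * p₂)]

theorem Measurable.dualWeight {w : (Fin n → ℝ) → ℝ≥0∞} (hw : Measurable w) (r p : ℝ) :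
    Measurable (dualWeight r p w) := hw.pow_const _

theorem Measurable.productWeight {w₁ w₂ : (Fin n → ℝ) → ℝ≥0∞} (hw₁ : Measurable w₁)
    (hw₂ : Measurable w₂) (p₁ p₂ q : ℝ) : Measurable (productWeight p₁ p₂ q w₁ w₂) :=
  (hw₁.pow_const _).mul (hw₂.pow_const _)

theorem ENNReal.rpow_ne_zero_of_ne {a : ℝ≥0∞} (h0 : a ≠ 0) (ht : a ≠ ∞) (z : ℝ) : a ^ z ≠ 0 := by
  simp [ENNReal.rpow_eq_zero_iff, h0, ht]

theorem ENNReal.rpow_ne_top_of_ne {a : ℝ≥0∞} (h0 : a ≠ 0) (ht : a ≠ ∞) (z : ℝ) : a ^ z ≠ ∞ := by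
  simp [ENNReal.rpow_eq_top_iff, h0, ht]

theorem ae_dualWeight {w : (Fin n → ℝ) → ℝ≥0∞} (hw : IsWeight w) (r p : ℝ) :
    ∀ᵐ x, dualWeight r p w x ≠ 0 ∧ dualWeight r p w x ≠ ∞ := by
  filter_upwards [hw.pos, hw.lt_top] with x h0 ht
  exact ⟨ENNReal.rpow_ne_zero_of_ne h0.ne' ht.ne _, ENNReal.rpow_ne_top_of_ne h0.ne' ht.ne _⟩

/-- This identity makes the L^p(w) norm of f an L^(p/r) norm of |f|^r/σ with respect to σ, and gives
the norm of the test function σ^(1/r). -/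
theorem ae_dualWeight_rpow_mul {w : (Fin n → ℝ) → ℝ≥0∞} (hw : IsWeight w) {r p : ℝ} (hr : 0 < r)
    (hrp : r < p) : ∀ᵐ x, dualWeight r p w x ^ (p / r) * w x = dualWeight r p w x := by
  filter_upwards [hw.pos, hw.lt_top] with x h0 ht
  have : p - r ≠ 0 := (sub_pos.2 hrp).ne'
  unfold dualWeight
  rw [← ENNReal.rpow_mul]
  nth_rewrite 2 [← ENNReal.rpow_one (w x)]
  rw [← ENNReal.rpow_add _ _ h0.ne' ht.ne]
  congr 1
  field_simp
  ring

theorem setLIntegral_cube_prod {r s p₁ p₂ q : ℝ} {w₁ w₂ : (Fin n → ℝ) → ℝ≥0∞}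
    (hr : 0 < r) (hrp : r < p₁) (hs : 0 < s) (hsp : s < p₂) (hq₀ : 0 < q)
    (a : Fin n → ℝ) {ℓ : ℝ} (hℓ : 0 < ℓ) :
    (⨍⁻ x in cube a ℓ, productWeight p₁ p₂ q w₁ w₂ x ∂volume) ^ (1 / q) *
      (⨍⁻ x in cube a ℓ, dualWeight r p₁ w₁ x ∂volume) ^ ((p₁ - r) / (r * p₁)) *
      (⨍⁻ x in cube a ℓ, dualWeight s p₂ w₂ x ∂volume) ^ ((p₂ - s) / (s * p₂)) *
      volume (cube a ℓ) ^ (1 / q + (p₁ - r) / (r * p₁) + (p₂ - s) / (s * p₂)) =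
    (∫⁻ x in cube a ℓ, productWeight p₁ p₂ q w₁ w₂ x) ^ (1 / q) *
      (∫⁻ x in cube a ℓ, dualWeight r p₁ w₁ x) ^ ((p₁ - r) / (r * p₁)) *
      (∫⁻ x in cube a ℓ, dualWeight s p₂ w₂ x) ^ ((p₂ - s) / (s * p₂)) := by
  have h1 : 0 < p₁ - r := sub_pos.2 hrp
  have h2 : 0 < p₂ - s := sub_pos.2 hsp
  have h3 : 0 < p₁ := hr.trans hrp
  have h4 : 0 < p₂ := hs.trans hsp
  simp only [setLAverage_eq]
  exact prod_div_rpow (volume_cube_ne_zero a hℓ) (volume_cube_ne_top a hℓ) (by positivity)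
    (by positivity) (by positivity)

theorem isMuckenhouptFamily_weightFamily {r s p₁ p₂ q : ℝ} {w₁ w₂ : (Fin n → ℝ) → ℝ≥0∞}
    (hr : 0 < r) (hrp : r < p₁) (hs : 0 < s) (hsp : s < p₂) (hq₀ : 0 < q)
    (hw₁ : IsWeight w₁) (hw₂ : IsWeight w₂) (hm₁ : Measurable w₁) (hm₂ : Measurable w₂)
    (h : PowerCondition r s p₁ p₂ q w₁ w₂) :
    ∃ K, IsMuckenhouptFamily (weightFamily r s p₁ p₂ q w₁ w₂) (exponentFamily r s p₁ p₂ q) K := by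
  have h1 : 0 < p₁ - r := sub_pos.2 hrp
  have h2 : 0 < p₂ - s := sub_pos.2 hsp
  have h3 : 0 < p₁ := hr.trans hrp
  have h4 : 0 < p₂ := hs.trans hsp
  obtain ⟨K, hK⟩ := WithTop.ne_top_iff_exists.1 h.ne
  have hprod : ∀ᵐ x, productWeight p₁ p₂ q w₁ w₂ x ≠ 0 ∧ productWeight p₁ p₂ q w₁ w₂ x ≠ ∞ := by
    filter_upwards [hw₁.pos, hw₁.lt_top, hw₂.pos, hw₂.lt_top] with x a1 b1 a2 b2
    exact ⟨mul_ne_zero (ENNReal.rpow_ne_zero_of_ne a1.ne' b1.ne _)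
        (ENNReal.rpow_ne_zero_of_ne a2.ne' b2.ne _),
      ENNReal.mul_ne_top (ENNReal.rpow_ne_top_of_ne a1.ne' b1.ne _)
        (ENNReal.rpow_ne_top_of_ne a2.ne' b2.ne _)⟩
  refine ⟨K, ⟨?_, ?_, ?_, ?_, ?_, ?_⟩⟩
  · exact Fin.forall_fin_succ.2 ⟨hm₁.productWeight hm₂ _ _ _,
      Fin.forall_fin_two.2 ⟨hm₁.dualWeight _ _, hm₂.dualWeight _ _⟩⟩
  · exact Fin.forall_fin_succ.2 ⟨hprod.mono fun _ hx => hx.1, Fin.forall_fin_two.2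
      ⟨(ae_dualWeight hw₁ r p₁).mono fun _ hx => hx.1,
        (ae_dualWeight hw₂ s p₂).mono fun _ hx => hx.1⟩⟩
  · exact Fin.forall_fin_succ.2 ⟨hprod.mono fun _ hx => hx.2, Fin.forall_fin_two.2
      ⟨(ae_dualWeight hw₁ r p₁).mono fun _ hx => hx.2,
        (ae_dualWeight hw₂ s p₂).mono fun _ hx => hx.2⟩⟩
  · refine Fin.forall_fin_succ.2 ⟨?_, Fin.forall_fin_two.2 ⟨?_, ?_⟩⟩
    · exact one_div_pos.2 hq₀
    · exact div_pos h1 (mul_pos hr h3)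
    · exact div_pos h2 (mul_pos hs h4)
  · filter_upwards [hw₁.pos, hw₁.lt_top, hw₂.pos, hw₂.lt_top] with x a1 b1 a2 b2
    rw [Fin.prod_univ_three]
    change (w₁ x ^ (q / p₁) * w₂ x ^ (q / p₂)) ^ (1 / q) *
      (w₁ x ^ (-(r / (p₁ - r)))) ^ ((p₁ - r) / (r * p₁)) *
      (w₂ x ^ (-(s / (p₂ - s)))) ^ ((p₂ - s) / (s * p₂)) = 1
    rw [ENNReal.mul_rpow_of_nonneg _ _ (by positivity)]
    simp only [← ENNReal.rpow_mul]
    have c1 : q / p₁ * (1 / q) = 1 / p₁ := by field_simp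
    have c2 : q / p₂ * (1 / q) = 1 / p₂ := by field_simp
    have c3 : -(r / (p₁ - r)) * ((p₁ - r) / (r * p₁)) = -(1 / p₁) := by field_simp
    have c4 : -(s / (p₂ - s)) * ((p₂ - s) / (s * p₂)) = -(1 / p₂) := by field_simp
    rw [c1, c2, c3, c4]
    calc _ = (w₁ x ^ (1 / p₁) * w₁ x ^ (-(1 / p₁))) *
          (w₂ x ^ (1 / p₂) * w₂ x ^ (-(1 / p₂))) := by ring
      _ = 1 := by
        rw [← ENNReal.rpow_add _ _ a1.ne' b1.ne, ← ENNReal.rpow_add _ _ a2.ne' b2.ne]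
        simp
  · intro c R hR
    -- The open and the closed cube have the same volume, so the condition on closed cubes passes to
    -- open ones without loss.
    have hsub : ball c R ⊆ cube (fun i => c i - R) (2 * R) := by
      rw [← closedBall_eq_cube c hR.le]; exact ball_subset_closedBall
    have hvol : volume (ball c R) = volume (cube (fun i => c i - R) (2 * R)) := by
      rw [← closedBall_eq_cube c hR.le, volume_closedBall_pi_eq_ball c hR]
    rw [Fin.prod_univ_three, Fin.sum_univ_three, hvol]
    change (∫⁻ x in ball c R, productWeight p₁ p₂ q w₁ w₂ x) ^ (1 / q) *
      (∫⁻ x in ball c R, dualWeight r p₁ w₁ x) ^ ((p₁ - r) / (r * p₁)) *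
      (∫⁻ x in ball c R, dualWeight s p₂ w₂ x) ^ ((p₂ - s) / (s * p₂)) ≤
      K * _ ^ (1 / q + (p₁ - r) / (r * p₁) + (p₂ - s) / (s * p₂))
    have hmono := fun f : (Fin n → ℝ) → ℝ≥0∞ => lintegral_mono_set (μ := volume) (f := f) hsub
    refine (mul_le_mul' (mul_le_mul' (ENNReal.rpow_le_rpow (hmono _) (by positivity))
      (ENNReal.rpow_le_rpow (hmono _) (by positivity)))
      (ENNReal.rpow_le_rpow (hmono _) (by positivity))).trans ?_
    rw [← setLIntegral_cube_prod hr hrp hs hsp hq₀ _ (by positivity : 0 < 2 * R)]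
    refine mul_le_mul_left ?_ _
    refine le_trans ?_ hK.ge
    exact le_iSup_of_le (fun i => c i - R) (le_iSup_of_le (2 * R)
      (le_iSup_of_le (by positivity : 0 < 2 * R) le_rfl))

theorem eLpNorm_ofReal_eq {X E : Type*} [MeasurableSpace X] [TopologicalSpace E]
    [ContinuousENorm E] {f : X → E} {μ : Measure X} {p : ℝ} (hp : 0 < p) :
    eLpNorm f (ENNReal.ofReal p) μ = (∫⁻ x, ‖f x‖ₑ ^ p ∂μ) ^ (1 / p) := by
  rw [eLpNorm_eq_lintegral_rpow_enorm_toReal (by simpa using hp) ENNReal.ofReal_ne_top,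
    ENNReal.toReal_ofReal hp.le]

theorem lintegral_weightMeasure {w f : (Fin n → ℝ) → ℝ≥0∞} (hw : Measurable w)
    (hf : AEMeasurable f) : ∫⁻ x, f x ∂(weightMeasure w) = ∫⁻ x, w x * f x :=
  lintegral_withDensity_eq_lintegral_mul₀ hw.aemeasurable hf

/-- The change of function `|f|^r = φ σ` with `σ` the dual weight of `w`. -/
theorem exists_dual_factor {w : (Fin n → ℝ) → ℝ≥0∞} (hw : IsWeight w) (hm : Measurable w)
    {r p : ℝ} (hr : 0 < r) (hrp : r < p) {f : (Fin n → ℝ) → ℂ}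
    (hf : AEStronglyMeasurable f (weightMeasure w)) :
    ∃ φ : (Fin n → ℝ) → ℝ≥0∞, Measurable φ ∧
      (∀ᵐ x, dualWeight r p w x * φ x = ‖f x‖ₑ ^ r) ∧
      (∫⁻ x, dualWeight r p w x * φ x ^ (p / r)) ^ (1 / p) =
        eLpNorm f (ENNReal.ofReal p) (weightMeasure w) := by
  have hp : 0 < p := hr.trans hrp
  -- As w > 0 a.e., measurability of f for w dx implies it for Lebesgue measure.
  have hac : volume ≪ weightMeasure w :=
    withDensity_absolutelyContinuous' hm.aemeasurable (hw.pos.mono fun _ h => h.ne')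
  have hF : AEMeasurable (fun x => ‖f x‖ₑ) volume := (hf.mono_ac hac).enorm
  have hmk : ∀ᵐ x, ‖f x‖ₑ = hF.mk _ x := hF.ae_eq_mk
  refine ⟨fun x => hF.mk _ x ^ r / dualWeight r p w x,
    (hF.measurable_mk.pow_const r).div (hm.dualWeight r p), ?_, ?_⟩
  · filter_upwards [hmk, ae_dualWeight hw r p] with x hx hd
    rw [ENNReal.mul_div_cancel hd.1 hd.2, hx]
  · rw [eLpNorm_ofReal_eq hp, lintegral_weightMeasure hm (hF.pow_const p)]
    congr 1
    refine lintegral_congr_ae ?_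
    filter_upwards [hmk, ae_dualWeight hw r p, ae_dualWeight_rpow_mul hw hr hrp] with x hx hd hdw
    have hpr : 0 ≤ p / r := by positivity
    have h1 := ENNReal.rpow_ne_zero_of_ne hd.1 hd.2 (p / r)
    have h2 := ENNReal.rpow_ne_top_of_ne hd.1 hd.2 (p / r)
    nth_rewrite 1 [← hdw]
    rw [ENNReal.div_rpow_of_nonneg _ _ hpr, ← ENNReal.rpow_mul, mul_div_cancel₀ _ hr.ne', hx,
      mul_comm (_ ^ (p / r)), mul_assoc, ENNReal.mul_div_cancel h1 h2]

theorem bilinearMaximal_le_familyMaximal {α r s : ℝ} (hα : 0 ≤ α) (hr : 0 < r) (hs : 0 < s)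
    {v : Fin 3 → (Fin n → ℝ) → ℝ≥0∞} {φ ψ : (Fin n → ℝ) → ℝ≥0∞} {f g : (Fin n → ℝ) → ℂ}
    (hf : ∀ᵐ x, v 1 x * φ x = ‖f x‖ₑ ^ r) (hg : ∀ᵐ x, v 2 x * ψ x = ‖g x‖ₑ ^ s)
    (x : Fin n → ℝ) :
    bilinearMaximal α r s f g x ≤ ((2 ^ n) ^ (1 / r) * (2 ^ n) ^ (1 / s)) *
      familyMaximal v (α / n) (1 / r) (1 / s) φ ψ x := by
  refine iSup_le fun a => iSup_le fun ℓ => iSup_le fun hℓ => iSup_le fun hx => ?_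
  have h1 := laverage_cube_le (fun x => ‖f x‖ₑ ^ r) a hℓ
  have h2 := laverage_cube_le (fun x => ‖g x‖ₑ ^ s) a hℓ
  rw [laverage_congr (μ := volume.restrict (ball _ _))
    (ae_restrict_of_ae (hf.mono fun _ h => h.symm))] at h1
  rw [laverage_congr (μ := volume.restrict (ball _ _))
    (ae_restrict_of_ae (hg.mono fun _ h => h.symm))] at h2
  set B := ball (fun i => a i + ℓ / 2) ℓ with hB
  have hr' : 0 ≤ 1 / r := by positivity
  have hs' : 0 ≤ 1 / s := by positivity
  calc _ ≤ volume B ^ (α / n) * (2 ^ n * ⨍⁻ y in B, v 1 y * φ y ∂volume) ^ (1 / r) *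
        (2 ^ n * ⨍⁻ y in B, v 2 y * ψ y ∂volume) ^ (1 / s) := by
        gcongr
        exact cube_subset_ball a hℓ
    _ = ((2 ^ n) ^ (1 / r) * (2 ^ n) ^ (1 / s)) * (volume B ^ (α / n) *
        (⨍⁻ y in B, v 1 y * φ y ∂volume) ^ (1 / r) *
        (⨍⁻ y in B, v 2 y * ψ y ∂volume) ^ (1 / s)) := by
        rw [ENNReal.mul_rpow_of_nonneg _ _ hr', ENNReal.mul_rpow_of_nonneg _ _ hs']
        ring
    _ ≤ _ := by
        refine mul_le_mul_right ?_ _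
        exact le_iSup_of_le (fun i => a i + ℓ / 2) (le_iSup_of_le ℓ (le_iSup_of_le hℓ
          (le_iSup_of_le (cube_subset_ball a hℓ hx) le_rfl)))

theorem strongBound_of_powerCondition {α r s p₁ p₂ p q : ℝ} {w₁ w₂ : (Fin n → ℝ) → ℝ≥0∞}
    (hα₀ : 0 ≤ α) (hr : 0 < r) (hrp : r < p₁) (hs : 0 < s) (hsp : s < p₂)
    (hp : 1 / p = 1 / p₁ + 1 / p₂) (hq₀ : 0 < q) (hq : 1 / q = 1 / p - α / n)
    (hw₁ : IsWeight w₁) (hw₂ : IsWeight w₂) (hm₁ : Measurable w₁) (hm₂ : Measurable w₂)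
    (h : PowerCondition r s p₁ p₂ q w₁ w₂) :
    StrongBound α r s p₁ p₂ q w₁ w₂ (productWeight p₁ p₂ q w₁ w₂) := by
  have hp₁ : 0 < p₁ := hr.trans hrp
  have hp₂ : 0 < p₂ := hs.trans hsp
  have hp₀ : 0 < p := by
    rw [← one_div_pos, hp]; positivity
  obtain ⟨K, hK⟩ := isMuckenhouptFamily_weightFamily hr hrp hs hsp hq₀ hw₁ hw₂ hm₁ hm₂ h
  obtain ⟨C, hC⟩ := hK.exists_lintegral_familyMaximal_rpow_le (β := α / n) (by positivity) hr hs
    hrp hsp hp₀ hq₀ hp hq rfl (show (p₁ - r) / (r * p₁) = _ by field_simp)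
    (show (p₂ - s) / (s * p₂) = _ by field_simp)
  set L : ℝ≥0 := (2 ^ n) ^ (1 / r) * (2 ^ n) ^ (1 / s) with hL
  have hLc : (L : ℝ≥0∞) = (2 ^ n) ^ (1 / r) * (2 ^ n) ^ (1 / s) := by
    rw [hL]
    push_cast
    rw [ENNReal.coe_rpow_of_nonneg _ (by positivity), ENNReal.coe_rpow_of_nonneg _ (by positivity)]
    simp
  refine ⟨L * C ^ (1 / q), fun f g hf hg => ?_⟩
  obtain ⟨φ, hφ, hφf, hφn⟩ := exists_dual_factor hw₁ hm₁ hr hrp hf.1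
  obtain ⟨ψ, hψ, hψg, hψn⟩ := exists_dual_factor hw₂ hm₂ hs hsp hg.1
  set v := weightFamily r s p₁ p₂ q w₁ w₂ with hv
  have hle := bilinearMaximal_le_familyMaximal (v := v) hα₀ hr hs hφf hψg
  have hC' := hC φ ψ hφ hψ
  have hq' : 0 ≤ 1 / q := by positivity
  rw [eLpNorm_ofReal_eq hq₀, ← hφn, ← hψn]
  simp only [enorm_eq_self]
  calc (∫⁻ x, bilinearMaximal α r s f g x ^ q
        ∂(weightMeasure (productWeight p₁ p₂ q w₁ w₂))) ^ (1 / q)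
      ≤ (∫⁻ x, (L : ℝ≥0∞) ^ q * familyMaximal v (α / n) (1 / r) (1 / s) φ ψ x ^ q
        ∂(volume.withDensity (v 0))) ^ (1 / q) := by
        refine ENNReal.rpow_le_rpow (lintegral_mono fun x => ?_) hq'
        rw [← ENNReal.mul_rpow_of_nonneg _ _ hq₀.le, hLc]
        exact ENNReal.rpow_le_rpow (hle x) hq₀.le
    _ = ((L : ℝ≥0∞) ^ q * ∫⁻ x, familyMaximal v (α / n) (1 / r) (1 / s) φ ψ x ^ q
        ∂(volume.withDensity (v 0))) ^ (1 / q) := by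
        rw [lintegral_const_mul' _ _ (ENNReal.rpow_ne_top_of_nonneg hq₀.le ENNReal.coe_ne_top)]
    _ ≤ ((L : ℝ≥0∞) ^ q * (C * (∫⁻ y, v 1 y * φ y ^ (p₁ / r)) ^ (q / p₁) *
          (∫⁻ y, v 2 y * ψ y ^ (p₂ / s)) ^ (q / p₂))) ^ (1 / q) := by gcongr
    _ = _ := by
        have c1 : q / p₁ * (1 / q) = 1 / p₁ := by field_simp
        have c2 : q / p₂ * (1 / q) = 1 / p₂ := by field_simp
        rw [ENNReal.mul_rpow_of_nonneg _ _ hq', ENNReal.mul_rpow_of_nonneg _ _ hq',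
          ENNReal.mul_rpow_of_nonneg _ _ hq', ← ENNReal.rpow_mul, ← ENNReal.rpow_mul,
          ← ENNReal.rpow_mul, mul_one_div_cancel hq₀.ne', ENNReal.rpow_one, c1, c2]
        push_cast
        rw [ENNReal.coe_rpow_of_nonneg _ hq', ← mul_assoc, ← mul_assoc]
        rfl

end Weights

/-! ### Necessity of the power condition, by test functions. -/

section Necessity

open Metric Set

variable {n : ℕ}

/-- The part of a cube on which the dual weight is at most `k`. -/
def truncationSet (r p : ℝ) (w : (Fin n → ℝ) → ℝ≥0∞) (a : Fin n → ℝ) (ℓ : ℝ) (k : ℕ) :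
    Set (Fin n → ℝ) :=
  cube a ℓ ∩ {x | dualWeight r p w x ≤ k}

theorem measurableSet_truncationSet {w : (Fin n → ℝ) → ℝ≥0∞} (hm : Measurable w) (r p : ℝ)
    (a : Fin n → ℝ) (ℓ : ℝ) (k : ℕ) : MeasurableSet (truncationSet r p w a ℓ k) :=
  (measurableSet_cube a ℓ).inter (measurableSet_le (hm.dualWeight r p) measurable_const)

/-- Monotone convergence: the dual weight is finite a.e., so the truncation sets exhaust the cube up
to a null set. -/
theorem setLIntegral_cube_dualWeight {w : (Fin n → ℝ) → ℝ≥0∞} (hw : IsWeight w) (r p : ℝ)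
    (a : Fin n → ℝ) (ℓ : ℝ) : ∫⁻ x in cube a ℓ, dualWeight r p w x =
      ⨆ k, ∫⁻ x in truncationSet r p w a ℓ k, dualWeight r p w x := by
  rw [← setLIntegral_iUnion_of_directed]
  · refine setLIntegral_congr ?_
    filter_upwards [ae_dualWeight hw r p] with x hx
    refine propext ⟨fun h => ?_, fun h => ?_⟩
    · obtain ⟨k, hk⟩ := ENNReal.exists_nat_gt hx.2
      exact mem_iUnion.2 ⟨k, h, hk.le⟩
    · obtain ⟨k, hk⟩ := mem_iUnion.1 h
      exact hk.1
  · refine (monotone_nat_of_le_succ fun k x hx => ⟨hx.1, hx.2.out.trans ?_⟩).directed_le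
    exact_mod_cast k.le_succ

/-- The extremal test function for the maximal operator. -/
theorem exists_test_function {w : (Fin n → ℝ) → ℝ≥0∞} (hw : IsWeight w) (hm : Measurable w)
    {r p : ℝ} (hr : 0 < r) (hrp : r < p) (a : Fin n → ℝ) {ℓ : ℝ} (hℓ : 0 < ℓ) (k : ℕ) :
    ∃ f : (Fin n → ℝ) → ℂ, MemLp f (ENNReal.ofReal p) (weightMeasure w) ∧
      eLpNorm f (ENNReal.ofReal p) (weightMeasure w) =
        (∫⁻ x in truncationSet r p w a ℓ k, dualWeight r p w x) ^ (1 / p) ∧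
      ∫⁻ x in cube a ℓ, ‖f x‖ₑ ^ r = ∫⁻ x in truncationSet r p w a ℓ k, dualWeight r p w x := by
  have hp : 0 < p := hr.trans hrp
  set E := truncationSet r p w a ℓ k with hE
  have hmE : MeasurableSet E := measurableSet_truncationSet hm r p a ℓ k
  set F : (Fin n → ℝ) → ℝ≥0∞ := E.indicator fun x => dualWeight r p w x ^ (1 / r) with hF
  have hmF : Measurable F := ((hm.dualWeight r p).pow_const _).indicator hmE
  have hFt : ∀ x, F x ≠ ∞ := by
    intro x
    by_cases hx : x ∈ E
    · rw [hF, indicator_of_mem hx]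
      exact ENNReal.rpow_ne_top_of_nonneg (by positivity)
        (ne_top_of_le_ne_top (ENNReal.natCast_ne_top k) hx.2)
    · simp [hF, hx]
  have henorm : ∀ x, ‖((F x).toReal : ℂ)‖ₑ = F x := by
    intro x
    rw [← enorm_norm, Complex.norm_real, enorm_norm, Real.enorm_toReal (hFt x)]
  have hpow : ∀ {z : ℝ}, 0 < z → ∀ x, F x ^ z =
      E.indicator (fun x => dualWeight r p w x ^ (z / r)) x := by
    intro z hz x
    by_cases hx : x ∈ E
    · rw [hF, indicator_of_mem hx, indicator_of_mem hx, ← ENNReal.rpow_mul]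
      congr 1
      ring
    · rw [hF, indicator_of_notMem hx, indicator_of_notMem hx, ENNReal.zero_rpow_of_pos hz]
  have hnorm : eLpNorm (fun x => ((F x).toReal : ℂ)) (ENNReal.ofReal p) (weightMeasure w) =
      (∫⁻ x in E, dualWeight r p w x) ^ (1 / p) := by
    rw [eLpNorm_ofReal_eq hp]
    simp_rw [henorm]
    rw [lintegral_weightMeasure hm (hmF.pow_const p).aemeasurable, ← lintegral_indicator hmE]
    congr 1
    refine lintegral_congr_ae ?_
    filter_upwards [ae_dualWeight_rpow_mul hw hr hrp] with x hx
    rw [hpow hp]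
    by_cases hxE : x ∈ E
    · rw [indicator_of_mem hxE, indicator_of_mem hxE, mul_comm, hx]
    · simp [hxE]
  refine ⟨fun x => ((F x).toReal : ℂ), ⟨?_, ?_⟩, hnorm, ?_⟩
  · exact (Complex.measurable_ofReal.comp hmF.ennreal_toReal).aestronglyMeasurable
  · rw [hnorm]
    refine ENNReal.rpow_lt_top_of_nonneg (by positivity) (ne_of_lt ?_)
    calc ∫⁻ x in E, dualWeight r p w x ≤ ∫⁻ _ in E, (k : ℝ≥0∞) :=
          setLIntegral_mono measurable_const fun x hx => hx.2
      _ = k * volume E := setLIntegral_const _ _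
      _ ≤ k * volume (cube a ℓ) := by gcongr; exact fun x hx => hx.1
      _ < ∞ := ENNReal.mul_lt_top (ENNReal.natCast_lt_top k)
          (volume_cube_ne_top a hℓ).lt_top
  · simp_rw [henorm, hpow hr, div_self hr.ne', ENNReal.rpow_one]
    rw [lintegral_indicator hmE, Measure.restrict_restrict hmE,
      inter_eq_self_of_subset_left fun x hx => hx.1]

/-- Every point of the cube admits that cube in its supremum, so the maximal function is at least
this constant there. -/
theorem term_mul_le_eLpNorm_bilinearMaximal {α r s q : ℝ} (hq₀ : 0 < q)
    {u : (Fin n → ℝ) → ℝ≥0∞} (f g : (Fin n → ℝ) → ℂ)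
    (a : Fin n → ℝ) {ℓ : ℝ} (hℓ : 0 < ℓ) :
    volume (cube a ℓ) ^ (α / n) *
      (⨍⁻ y in cube a ℓ, ‖f y‖ₑ ^ r ∂volume) ^ (1 / r) *
      (⨍⁻ y in cube a ℓ, ‖g y‖ₑ ^ s ∂volume) ^ (1 / s) *
      (∫⁻ x in cube a ℓ, u x) ^ (1 / q) ≤
      eLpNorm (bilinearMaximal α r s f g) (ENNReal.ofReal q) (weightMeasure u) := by
  rw [eLpNorm_ofReal_eq hq₀]
  set T := volume (cube a ℓ) ^ (α / n) *
      (⨍⁻ y in cube a ℓ, ‖f y‖ₑ ^ r ∂volume) ^ (1 / r) *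
      (⨍⁻ y in cube a ℓ, ‖g y‖ₑ ^ s ∂volume) ^ (1 / s) with hT
  have hq' : 0 ≤ 1 / q := by positivity
  calc T * (∫⁻ x in cube a ℓ, u x) ^ (1 / q)
      = (∫⁻ _ in cube a ℓ, T ^ q ∂(weightMeasure u)) ^ (1 / q) := by
        rw [setLIntegral_const, weightMeasure, withDensity_apply _ (measurableSet_cube a ℓ),
          ENNReal.mul_rpow_of_nonneg _ _ hq', ← ENNReal.rpow_mul, mul_one_div_cancel hq₀.ne',
          ENNReal.rpow_one]
    _ ≤ (∫⁻ x in cube a ℓ, ‖bilinearMaximal α r s f g x‖ₑ ^ q ∂(weightMeasure u)) ^ (1 / q) := by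
        refine ENNReal.rpow_le_rpow (setLIntegral_mono' (measurableSet_cube a ℓ) fun x hx => ?_) hq'
        rw [enorm_eq_self]
        refine ENNReal.rpow_le_rpow ?_ hq₀.le
        exact le_iSup_of_le a (le_iSup_of_le ℓ (le_iSup_of_le hℓ (le_iSup_of_le hx le_rfl)))
    _ ≤ _ := ENNReal.rpow_le_rpow (setLIntegral_le_lintegral _ _) hq'

/-- Cancellation of the norms of the test functions. -/
theorem rpow_mul_rpow_le_of_le {A B U V C : ℝ≥0∞} {β r s p₁ p₂ q : ℝ} (hr : 0 < r) (hrp : r < p₁)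
    (hs : 0 < s) (hsp : s < p₂) (hq : 1 / q = 1 / p₁ + 1 / p₂ - β)
    (hAt : A ≠ ∞) (hBt : B ≠ ∞) (hV0 : V ≠ 0) (hVt : V ≠ ∞)
    (h : V ^ β * (A / V) ^ (1 / r) * (B / V) ^ (1 / s) * U ^ (1 / q) ≤
      C * A ^ (1 / p₁) * B ^ (1 / p₂)) :
    U ^ (1 / q) * A ^ ((p₁ - r) / (r * p₁)) * B ^ ((p₂ - s) / (s * p₂)) ≤
      C * V ^ (1 / q + (p₁ - r) / (r * p₁) + (p₂ - s) / (s * p₂)) := by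
  have hp₁ : 0 < p₁ := hr.trans hrp
  have hp₂ : 0 < p₂ := hs.trans hsp
  have h1 : 0 < p₁ - r := sub_pos.2 hrp
  have h2 : 0 < p₂ - s := sub_pos.2 hsp
  have e1 : (p₁ - r) / (r * p₁) = 1 / r - 1 / p₁ := by field_simp
  have e2 : (p₂ - s) / (s * p₂) = 1 / s - 1 / p₂ := by field_simp
  have e1p : 0 < (p₁ - r) / (r * p₁) := by positivity
  have e2p : 0 < (p₂ - s) / (s * p₂) := by positivity
  by_cases hA0 : A = 0
  · simp [hA0, ENNReal.zero_rpow_of_pos e1p]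
  by_cases hB0 : B = 0
  · simp [hB0, ENNReal.zero_rpow_of_pos e2p]
  set N := 1 / q + (p₁ - r) / (r * p₁) + (p₂ - s) / (s * p₂) with hN
  have hNe : N = 1 / r + 1 / s - β := by rw [hN, hq, e1, e2]; ring
  -- Dividing by the norms of the test functions needs them nonzero and finite: the zero cases are
  -- trivial above, and finiteness is what the truncation provides.
  have hP0 : A ^ (1 / p₁) * B ^ (1 / p₂) ≠ 0 :=
    mul_ne_zero (ENNReal.rpow_ne_zero_of_ne hA0 hAt _) (ENNReal.rpow_ne_zero_of_ne hB0 hBt _)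
  have hPt : A ^ (1 / p₁) * B ^ (1 / p₂) ≠ ∞ :=
    ENNReal.mul_ne_top (ENNReal.rpow_ne_top_of_ne hA0 hAt _) (ENNReal.rpow_ne_top_of_ne hB0 hBt _)
  rw [← ENNReal.mul_le_mul_iff_left hP0 hPt]
  have hA : A ^ ((p₁ - r) / (r * p₁)) * A ^ (1 / p₁) = A ^ (1 / r) := by
    rw [← ENNReal.rpow_add _ _ hA0 hAt, e1, sub_add_cancel]
  have hB : B ^ ((p₂ - s) / (s * p₂)) * B ^ (1 / p₂) = B ^ (1 / s) := by
    rw [← ENNReal.rpow_add _ _ hB0 hBt, e2, sub_add_cancel]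
  have hV : V ^ β * V ^ N = V ^ (1 / r) * V ^ (1 / s) := by
    rw [← ENNReal.rpow_add _ _ hV0 hVt, ← ENNReal.rpow_add _ _ hV0 hVt, hNe]
    ring_nf
  have hr' : 0 ≤ 1 / r := by positivity
  have hs' : 0 ≤ 1 / s := by positivity
  calc _ = U ^ (1 / q) * (A ^ ((p₁ - r) / (r * p₁)) * A ^ (1 / p₁)) *
        (B ^ ((p₂ - s) / (s * p₂)) * B ^ (1 / p₂)) := by ring
    _ = U ^ (1 / q) * (A / V * V) ^ (1 / r) * (B / V * V) ^ (1 / s) := by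
      rw [hA, hB, ENNReal.div_mul_cancel hV0 hVt, ENNReal.div_mul_cancel hV0 hVt]
    _ = (A / V) ^ (1 / r) * (B / V) ^ (1 / s) * U ^ (1 / q) * (V ^ (1 / r) * V ^ (1 / s)) := by
      rw [ENNReal.mul_rpow_of_nonneg _ _ hr', ENNReal.mul_rpow_of_nonneg _ _ hs']; ring
    _ = (V ^ β * (A / V) ^ (1 / r) * (B / V) ^ (1 / s) * U ^ (1 / q)) * V ^ N := by
      rw [← hV]; ring
    _ ≤ (C * A ^ (1 / p₁) * B ^ (1 / p₂)) * V ^ N := by gcongr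
    _ = _ := by ring

theorem powerCondition_of_strongBound {α r s p₁ p₂ p q : ℝ} {w₁ w₂ : (Fin n → ℝ) → ℝ≥0∞}
    (hr : 0 < r) (hrp : r < p₁) (hs : 0 < s) (hsp : s < p₂)
    (hp : 1 / p = 1 / p₁ + 1 / p₂) (hq₀ : 0 < q) (hq : 1 / q = 1 / p - α / n)
    (hw₁ : IsWeight w₁) (hw₂ : IsWeight w₂) (hm₁ : Measurable w₁) (hm₂ : Measurable w₂)
    (h : StrongBound α r s p₁ p₂ q w₁ w₂ (productWeight p₁ p₂ q w₁ w₂)) :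
    PowerCondition r s p₁ p₂ q w₁ w₂ := by
  obtain ⟨C, hC⟩ := h
  have hp₁ : 0 < p₁ := hr.trans hrp
  have hp₂ : 0 < p₂ := hs.trans hsp
  refine lt_of_le_of_lt (iSup_le fun a => iSup_le fun ℓ => iSup_le fun hℓ => ?_)
    (ENNReal.coe_lt_top (r := C))
  have e1p : 0 < (p₁ - r) / (r * p₁) := div_pos (sub_pos.2 hrp) (mul_pos hr hp₁)
  have e2p : 0 < (p₂ - s) / (s * p₂) := div_pos (sub_pos.2 hsp) (mul_pos hs hp₂)
  set N := 1 / q + (p₁ - r) / (r * p₁) + (p₂ - s) / (s * p₂) with hN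
  have hV0 := volume_cube_ne_zero a hℓ
  have hVt := volume_cube_ne_top a hℓ
  rw [← ENNReal.mul_le_mul_iff_left (ENNReal.rpow_ne_zero_of_ne hV0 hVt N)
    (ENNReal.rpow_ne_top_of_ne hV0 hVt N)]
  refine (setLIntegral_cube_prod hr hrp hs hsp hq₀ a hℓ).trans_le ?_
  -- Positive powers are order isomorphisms of [0, ∞], so both suprema move outside the product and
  -- each pair of truncations is tested separately.
  rw [setLIntegral_cube_dualWeight hw₁, setLIntegral_cube_dualWeight hw₂,
    ← ENNReal.orderIsoRpow_apply _ e1p, ← ENNReal.orderIsoRpow_apply _ e2p, OrderIso.map_iSup,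
    OrderIso.map_iSup]
  simp only [ENNReal.orderIsoRpow_apply, ENNReal.mul_iSup, ENNReal.iSup_mul]
  refine iSup_le fun l => iSup_le fun k => ?_
  obtain ⟨f, hf, hfn, hfr⟩ := exists_test_function hw₁ hm₁ hr hrp a hℓ k
  obtain ⟨g, hg, hgn, hgs⟩ := exists_test_function hw₂ hm₂ hs hsp a hℓ l
  have h1 := (term_mul_le_eLpNorm_bilinearMaximal (α := α) (r := r) (s := s) hq₀
    (u := productWeight p₁ p₂ q w₁ w₂) f g a hℓ).trans (hC f g hf hg)
  have hft := hf.2.ne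
  have hgt := hg.2.ne
  rw [hfn, Ne, ENNReal.rpow_eq_top_iff_of_pos (by positivity)] at hft
  rw [hgn, Ne, ENNReal.rpow_eq_top_iff_of_pos (by positivity)] at hgt
  rw [setLAverage_eq, setLAverage_eq, hfr, hgs, hfn, hgn] at h1
  exact rpow_mul_rpow_le_of_le hr hrp hs hsp (by rw [hq, hp]) hft hgt hV0 hVt h1

end Necessity

/-! ### Invariance under a.e. modification of the weights. -/

section Congruence

variable {n : ℕ}

theorem IsWeight.congr {w w' : (Fin n → ℝ) → ℝ≥0∞} (hw : IsWeight w) (h : w =ᵐ[volume] w') :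
    IsWeight w' :=
  ⟨hw.aemeasurable.congr h, by filter_upwards [hw.pos, h] with x h1 h2; rwa [← h2],
    by filter_upwards [hw.lt_top, h] with x h1 h2; rwa [← h2]⟩

theorem productWeight_congr {p₁ p₂ q : ℝ} {w₁ w₂ w₁' w₂' : (Fin n → ℝ) → ℝ≥0∞}
    (h₁ : w₁ =ᵐ[volume] w₁') (h₂ : w₂ =ᵐ[volume] w₂') :
    productWeight p₁ p₂ q w₁ w₂ =ᵐ[volume] productWeight p₁ p₂ q w₁' w₂' := by
  filter_upwards [h₁, h₂] with x hx₁ hx₂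
  simp only [productWeight, hx₁, hx₂]

theorem powerCondition_congr {r s p₁ p₂ q : ℝ} {w₁ w₂ w₁' w₂' : (Fin n → ℝ) → ℝ≥0∞}
    (h₁ : w₁ =ᵐ[volume] w₁') (h₂ : w₂ =ᵐ[volume] w₂') :
    PowerCondition r s p₁ p₂ q w₁ w₂ ↔ PowerCondition r s p₁ p₂ q w₁' w₂' := by
  have h := productWeight_congr (p₁ := p₁) (p₂ := p₂) (q := q) h₁ h₂
  have k₁ : (fun x => w₁ x ^ (-(r / (p₁ - r)))) =ᵐ[volume] fun x => w₁' x ^ (-(r / (p₁ - r))) :=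
    h₁.mono fun x hx => by simp only [hx]
  have k₂ : (fun x => w₂ x ^ (-(s / (p₂ - s)))) =ᵐ[volume] fun x => w₂' x ^ (-(s / (p₂ - s))) :=
    h₂.mono fun x hx => by simp only [hx]
  simp only [PowerCondition, laverage_congr (ae_restrict_of_ae h),
    laverage_congr (ae_restrict_of_ae k₁), laverage_congr (ae_restrict_of_ae k₂)]

theorem weightMeasure_congr {w w' : (Fin n → ℝ) → ℝ≥0∞} (h : w =ᵐ[volume] w') :
    weightMeasure w = weightMeasure w' := withDensity_congr_ae h

theorem strongBound_congr {α r s p₁ p₂ q : ℝ} {w₁ w₂ u w₁' w₂' u' : (Fin n → ℝ) → ℝ≥0∞}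
    (h₁ : w₁ =ᵐ[volume] w₁') (h₂ : w₂ =ᵐ[volume] w₂') (hu : u =ᵐ[volume] u') :
    StrongBound α r s p₁ p₂ q w₁ w₂ u ↔ StrongBound α r s p₁ p₂ q w₁' w₂' u' := by
  simp only [StrongBound, weightMeasure_congr h₁, weightMeasure_congr h₂, weightMeasure_congr hu]

end Congruence

theorem mainTheorem8 (n : ℕ) (α r s p₁ p₂ p q : ℝ)
    (hα₀ : 0 ≤ α) (hαn : α < n)
    (hr : 1 < r) (hrp : r < p₁) (hs : 1 < s) (hsp : s < p₂)
    (hp : 1 / p = 1 / p₁ + 1 / p₂)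
    (hq₀ : 0 < q) (hq : 1 / q = 1 / p - α / n)
    (w₁ w₂ : (Fin n → ℝ) → ℝ≥0∞) (hw₁ : IsWeight w₁) (hw₂ : IsWeight w₂) :
    StrongBound α r s p₁ p₂ q w₁ w₂ (productWeight p₁ p₂ q w₁ w₂) ↔
      PowerCondition r s p₁ p₂ q w₁ w₂ := by
  have h₁ := hw₁.aemeasurable.ae_eq_mk
  have h₂ := hw₂.aemeasurable.ae_eq_mk
  have m₁ := hw₁.aemeasurable.measurable_mk
  have m₂ := hw₂.aemeasurable.measurable_mk
  -- Both sides depend only on a.e. classes, so the weights may be replaced by Borel measurable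
  -- representatives.
  rw [strongBound_congr h₁ h₂ (productWeight_congr h₁ h₂), powerCondition_congr h₁ h₂]
  have hr₀ : 0 < r := by linarith
  have hs₀ : 0 < s := by linarith
  exact ⟨powerCondition_of_strongBound hr₀ hrp hs₀ hsp hp hq₀ hq (hw₁.congr h₁) (hw₂.congr h₂)
      m₁ m₂,
    strongBound_of_powerCondition hα₀ hr₀ hrp hs₀ hsp hp hq₀ hq (hw₁.congr h₁) (hw₂.congr h₂)
      m₁ m₂⟩
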